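/- **Setting.** Let $\mathcal H$ be a real separable Hilbert space, $C_0$ the covariance operator of a centred Gaussian measure $N(0,C_0)$ on $\mathcal H$, $\sqrt{C_0}$ its positive square root, and $\mathcal H^1=\operatorname{Im}\sqrt{C_0}$ the Cameron–Martin space with $\langle x,y\rangle_{C_0}=\langle C_0^{-1/2}x,C_0^{-1/2}y\rangle$ and $\|x\|_{C_0}=\|C_0^{-1/2}x\|$. Open sets, bounded sets and balls $B_R(x)$ below are those of $\mathcal H^1$. Let $m_0\in\mathcal H$, $\mu_0=N(m_0,C_0)$, let $\Phi_\mu:\mathcal H\to\mathbb R$ be measurable, and let $\mu$ be the probability measure with $\frac{d\mu}{d\mu_0}=\frac1{Z_\mu}e^{-\Phi_\mu}$, $0<Z_\mu<\infty$ (so $\mu\sim\mu_0$). For $x\in\mathcal H^1$ let $J(x)=\mathcal R(N(m_0+x,C_0)\,\|\,\mu)$ be the relative entropy (Kullback–Leibler divergence). Expectations $\mathbb E$ are over $\xi\sim N(0,C_0)$. $\Phi_\mu'(u)$ denotes the Fréchet derivative along $\mathcal H^1$, i.e. of $h\mapsto\Phi_\mu(u+h)$, $h\in\mathcal H^1$,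 at $h=0$; $C_0\Phi_\mu'(u)\in\mathcal H^1$ is its representer for $\langle\cdot,\cdot\rangle_{C_0}$, and $\|\sqrt{C_0}\Phi_\mu'(u)\|=\|C_0\Phi_\mu'(u)\|_{C_0}$. Put $F(x,\xi)=C_0\Phi_\mu'(x+m_0+\xi)+x$. **Algorithm.** Let $a_n>0$, $\sum a_n=\infty$, $\sum a_n^2<\infty$. Let $(\mathcal F_n)$ be a filtration and $\xi_1,\xi_2,\dots\sim N(0,C_0)$ with $\xi_{n+1}$ being $\mathcal F_{n+1}$-measurable and independent of $\mathcal F_n$. Given trust regions $U_0,U_1,\dots\subseteq\mathcal H^1$, start at an $\mathcal F_0$-measurable $x_0$ with $\sigma_0=0$, and let $x^{(p)}_{n+1}=x_n-a_{n+1}F(x_n,\xi_{n+1})$; if $x^{(p)}_{n+1}\in U_{\sigma_n}$, set $(x_{n+1},\sigma_{n+1})=(x^{(p)}_{n+1},\sigma_n)$; otherwise set $(x_{n+1},\sigma_{n+1})=(x_0^{(\sigma_n)},\sigma_n+1)$. The restart points $x_0^{(k)}$ may be fixed or random, but do not anticipate: the value of $x_0^{(k)}$ used at step $n$ is $\mathcal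 F_n$-measurable. **Assumptions.** (1) For a.e. $\xi$, the map $x\mapsto\Phi_\mu(x+m_0+\xi)$ is twice Fréchet differentiable on $\mathcal H^1$. (2) $x_\star\in\mathcal H^1$, $J(x_\star)<\infty$ and $J'(x_\star)=0$. (3) $x\mapsto\mathbb E\|\sqrt{C_0}\Phi_\mu'(x+m_0+\xi)\|^2$ is bounded on bounded subsets of $\mathcal H^1$. (4) There are a convex neighborhood $U_\star\subseteq\mathcal H^1$ of $x_\star$ and $\alpha>0$ with $\langle J''(x)u,u\rangle\ge\alpha\|u\|_{C_0}^2$ for all $x\in U_\star$, $u\in\mathcal H^1$, where $J''$ is the second Fréchet derivative of $J$ on $\mathcal H^1$. **Conclusion.** (a) *Expanding trust regions.* Suppose $U_\star=\mathcal H^1$, the $U_n$ are bounded and open, $U_0\subseteq U_1\subseteq\cdots$, $\bigcup_nU_n=\mathcal H^1$, $x_0\in U_0$, $x_0^{(k)}\in U_{k+1}$, and either all restart points lie in one compact subset of $\mathcal H^1$ (for instance, they all equal one fixed point), or all restart points lie in one bounded set and every bounded subset of $\mathcal H^1$ is contained in some $U_n$. Then $x_n\to x_\star$ in $\mathcal H^1$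 almost surely. (b) *Fixed trust region.* Suppose $U_1\subseteq U_\star$ is bounded, open and convex, $x_\star\in U_1$, $U_0\subseteq B_{R_0}(x_\star)\subset B_{R_1}(x_\star)\subseteq U_1$ with $R_0<R_1$, and $x_0$ and all restart points lie in $U_0$. Run the algorithm with the trust regions $U_1,U_1,\dots$ or, if $U_0$ is open, with $U_0,U_1,U_1,\dots$. Then $x_n\to x_\star$ in $\mathcal H^1$ almost surely. -/

import Mathlib

open MeasureTheory ProbabilityTheory Filter Topology

noncomputable section

section CameronMartin

variable {H : Type*} [NormedAddCommGroup H] [InnerProductSpace ℝ H] [CompleteSpace H]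

/-- The range `Im S` of a bounded operator `S`. For `S = √C₀` this is the Cameron–Martin space `H¹`
of `N(0, C₀)`. It is a type of its own, because its norm `‖S⁻¹ x‖` is not the norm of `H`. -/
def CameronMartin (S : H →L[ℝ] H) : Type _ := LinearMap.range S.toLinearMap

namespace CameronMartin

variable (S : H →L[ℝ] H)

instance instAddCommGroup : AddCommGroup (CameronMartin S) :=
  inferInstanceAs (AddCommGroup (LinearMap.range S.toLinearMap))

instance instModule : Module ℝ (CameronMartin S) :=
  inferInstanceAs (Module ℝ (LinearMap.range S.toLinearMap))

/-- The inverse `S⁻¹ : Im S → (ker S)ᗮ` (if `S` is injective, then `(ker S)ᗮ = H`). -/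
def inv : CameronMartin S ≃ₗ[ℝ] (S.kerᗮ : Submodule ℝ H) :=
  S.toLinearMap.quotKerEquivRange.symm.trans
    (Submodule.quotientEquivOfIsCompl S.ker S.kerᗮ S.ker.isCompl_orthogonal)

/-- The norm of the Cameron–Martin space is `‖x‖ = ‖S⁻¹ x‖_H`. -/
instance instNormedAddCommGroup : NormedAddCommGroup (CameronMartin S) :=
  NormedAddCommGroup.induced _ _ (inv S) (inv S).injective

/-- The inner product of the Cameron–Martin space is `⟪x, y⟫ = ⟪S⁻¹ x, S⁻¹ y⟫_H`. -/
instance instInnerProductSpace : InnerProductSpace ℝ (CameronMartin S) :=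
  InnerProductSpace.induced (inv S)

variable {S}

theorem norm_def (x : CameronMartin S) : ‖x‖ = ‖(inv S x : H)‖ := rfl

theorem inner_def (x y : CameronMartin S) :
    inner ℝ x y = inner ℝ (inv S x : H) (inv S y : H) := rfl

variable (S) in
/-- The inclusion of `Im S` in `H`, as a linear map. -/
def inclLinear : CameronMartin S →ₗ[ℝ] H := (LinearMap.range S.toLinearMap).subtype

theorem apply_inv (x : CameronMartin S) : S (inv S x : H) = inclLinear S x := by
  obtain ⟨z, rfl⟩ := (inv S).symm.surjective x
  rw [LinearEquiv.apply_symm_apply]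
  rfl

variable (S)

/-- The inclusion of `Im S` in `H`, which is continuous for the Cameron–Martin norm. -/
def incl : CameronMartin S →L[ℝ] H :=
  (inclLinear S).mkContinuous ‖S‖ fun x => by
    rw [norm_def, ← apply_inv]
    exact S.le_opNorm _

/-- `S⁻¹` as an isometry of the Cameron–Martin space onto `(ker S)ᗮ`. -/
def invIsometry : CameronMartin S ≃ₗᵢ[ℝ] (S.kerᗮ : Submodule ℝ H) :=
  { inv S with norm_map' := fun _ => rfl }

instance instCompleteSpace : CompleteSpace (CameronMartin S) :=
  (completeSpace_congr (e := (invIsometry S).toEquiv)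
    (invIsometry S).isometry.isUniformEmbedding).2 inferInstance

variable {S}

theorem incl_eq (x : CameronMartin S) : incl S x = S (inv S x : H) := (apply_inv x).symm

/-- The gradient of `Φ` at `u` along the Cameron–Martin space: the representer, in the
Cameron–Martin inner product, of the Fréchet derivative at `0` of `h ↦ Φ (u + h)`, `h ∈ Im S`.
For `S = √C₀` it is `C₀ Φ'(u)`, and its Cameron–Martin norm is `‖√C₀ Φ'(u)‖_H`: see
`incl_grad` and `norm_grad` for the case where `Φ` is differentiable on all of `H`. -/
def grad (S : H →L[ℝ] H) (Φ : H → ℝ) (u : H) : CameronMartin S :=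
  gradient (fun h : CameronMartin S => Φ (u + incl S h)) 0

theorem inv_grad (hS : S.IsPositive) {Φ : H → ℝ} {g u : H} (hg : HasGradientAt Φ g u) :
    (inv S (grad S Φ u) : H) = S g := by
  have hsym : ∀ x y : H, inner ℝ (S x) y = inner ℝ x (S y) := hS.isSymmetric
  have hmem : S g ∈ S.kerᗮ := by
    rw [Submodule.mem_orthogonal]
    intro z hz
    have hz' : S z = 0 := hz
    rw [← hsym, hz', inner_zero_left]
  have key : HasGradientAt (fun h : CameronMartin S => Φ (u + incl S h))
      ((inv S).symm ⟨S g, hmem⟩) 0 := by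
    rw [hasGradientAt_iff_hasFDerivAt]
    have h1 : HasFDerivAt (fun h : CameronMartin S => u + incl S h) (incl S) 0 :=
      (incl S).hasFDerivAt.const_add u
    have h2 : HasFDerivAt Φ (InnerProductSpace.toDual ℝ H g) (u + incl S 0) := by
      simpa using hg.hasFDerivAt
    have h3 : InnerProductSpace.toDual ℝ (CameronMartin S) ((inv S).symm ⟨S g, hmem⟩) =
        (InnerProductSpace.toDual ℝ H g).comp (incl S) := by
      ext h
      simp [inner_def, incl_eq, hsym]
    rw [h3]
    exact h2.comp (0 : CameronMartin S) h1
  rw [grad, key.gradient, LinearEquiv.apply_symm_apply]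

/-- As an element of `H`, the Cameron–Martin gradient is `S² Φ'(u) = C₀ Φ'(u)`. -/
theorem incl_grad (hS : S.IsPositive) {Φ : H → ℝ} {g u : H} (hg : HasGradientAt Φ g u) :
    incl S (grad S Φ u) = S (S g) := by
  rw [incl_eq, inv_grad hS hg]

/-- The Cameron–Martin norm of the Cameron–Martin gradient is `‖S Φ'(u)‖ = ‖√C₀ Φ'(u)‖`. -/
theorem norm_grad (hS : S.IsPositive) {Φ : H → ℝ} {g u : H} (hg : HasGradientAt Φ g u) :
    ‖grad S Φ u‖ = ‖S g‖ := by
  rw [norm_def, inv_grad hS hg]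

end CameronMartin

end CameronMartin

section RelativeEntropy

variable {H : Type*} [NormedAddCommGroup H] [InnerProductSpace ℝ H] [CompleteSpace H]
  [MeasurableSpace H] [BorelSpace H]

/-- `γ = N(0, C)`: a centred Gaussian measure with covariance operator `C`. -/
structure IsCentredGaussian (γ : Measure H) (C : H →L[ℝ] H) : Prop where
  isGaussian : IsGaussian γ
  mean_eq_zero : ∫ ξ, ξ ∂γ = 0
  covariance_eq : covarianceOperator γ = C

/-- `N(m, C)`, the law of `m + ξ` for `ξ ∼ γ = N(0, C)`. -/
def gaussianWithMean (γ : Measure H) (m : H) : Measure H := γ.map fun ξ => m + ξ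

/-- The relative entropy `R(N(m₀ + x, C₀) ‖ μ) ∈ [0, ∞]`, as a function of `x = m - m₀ ∈ H¹`. -/
def relEntropy (S : H →L[ℝ] H) (γ μ : Measure H) (m₀ : H) (x : CameronMartin S) : ENNReal :=
  InformationTheory.klDiv (gaussianWithMean γ (m₀ + CameronMartin.incl S x)) μ

/-- The objective `J(x) = R(N(m₀ + x, C₀) ‖ μ)`, as a real function on `H¹`. -/
def objective (S : H →L[ℝ] H) (γ μ : Measure H) (m₀ : H) (x : CameronMartin S) : ℝ :=
  (relEntropy S γ μ m₀ x).toReal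

/-- The noisy preconditioned gradient `F(x, ξ) = C₀ Φ'(x + m₀ + ξ) + x ∈ H¹`. -/
def noisyGradient (S : H →L[ℝ] H) (Φ : H → ℝ) (m₀ : H) (x : CameronMartin S) (ξ : H) :
    CameronMartin S :=
  CameronMartin.grad S Φ (CameronMartin.incl S x + m₀ + ξ) + x

end RelativeEntropy

section RobbinsMonro

open Classical in
/-- Robbins–Monro with truncations. The state after `n` steps is `(xₙ, σₙ)`, where `σₙ` counts the
truncations so far. The proposal `xₙ - aₙ₊₁ F(xₙ, ξₙ₊₁)` is accepted if it lies in the trust region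
`U σₙ`; otherwise the iteration restarts at `r σₙ (n + 1)` and `σ` increases by one. Here `r k n` is
the restart point that is used if the truncation number `k` takes place at step `n`; it does not
depend on `n` if the restart points are chosen in advance. -/
def truncatedRM {E Ξ : Type*} [AddCommGroup E] [Module ℝ E] (F : E → Ξ → E) (a : ℕ → ℝ)
    (U : ℕ → Set E) (x₀ : E) (r : ℕ → ℕ → E) (ξ : ℕ → Ξ) : ℕ → E × ℕ
  | 0 => (x₀, 0)
  | n + 1 =>
    let s := truncatedRM F a U x₀ r ξ n
    let p := s.1 - a (n + 1) • F s.1 (ξ (n + 1))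
    if p ∈ U s.2 then (p, s.2) else (r s.2 (n + 1), s.2 + 1)

end RobbinsMonro

end

section SecondMomentBound

variable {α β : Type*} [MeasurableSpace α] {ν : Measure α} [NormedAddCommGroup β]

theorem lintegral_enorm_sq_le_of_ae_tendsto {f : ℕ → α → β} {g : α → β} {K : NNReal}
    (hf : ∀ n, AEStronglyMeasurable (f n) ν)
    (hK : ∀ n, ∫⁻ x, ‖f n x‖ₑ ^ 2 ∂ν ≤ K)
    (hfg : ∀ᵐ x ∂ν, Tendsto (fun n => f n x) atTop (𝓝 (g x))) :
    ∫⁻ x, ‖g x‖ₑ ^ 2 ∂ν ≤ K := by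
  calc ∫⁻ x, ‖g x‖ₑ ^ 2 ∂ν = ∫⁻ x, liminf (fun n => ‖f n x‖ₑ ^ 2) atTop ∂ν := by
        refine lintegral_congr_ae ?_
        filter_upwards [hfg] with x hx
        exact (((ENNReal.continuous_pow 2).tendsto _).comp hx.enorm).liminf_eq.symm
    _ ≤ liminf (fun n => ∫⁻ x, ‖f n x‖ₑ ^ 2 ∂ν) atTop :=
        lintegral_liminf_le' fun n => (hf n).enorm.pow_const 2
    _ ≤ liminf (fun _ => (K : ENNReal)) atTop := liminf_le_liminf (.of_forall hK)
    _ = K := by simp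

theorem memLp_two_of_lintegral_enorm_sq_le {f : α → β} {K : NNReal}
    (hf : AEStronglyMeasurable f ν) (hK : ∫⁻ x, ‖f x‖ₑ ^ 2 ∂ν ≤ K) : MemLp f 2 ν := by
  refine ⟨hf, ?_⟩
  rw [eLpNorm_lt_top_iff_lintegral_rpow_enorm_lt_top (by simp) (by simp)]
  simpa using hK.trans_lt ENNReal.coe_lt_top

variable [IsFiniteMeasure ν] [NormedSpace ℝ β]

/-- Vitali's convergence theorem for a sequence that is bounded in `L²`. -/
theorem tendsto_integral_of_lintegral_enorm_sq_le {f : ℕ → α → β} {g : α → β} {K : NNReal}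
    (hf : ∀ n, AEStronglyMeasurable (f n) ν)
    (hK : ∀ n, ∫⁻ x, ‖f n x‖ₑ ^ 2 ∂ν ≤ K)
    (hfg : ∀ᵐ x ∂ν, Tendsto (fun n => f n x) atTop (𝓝 (g x))) :
    Tendsto (fun n => ∫ x, f n x ∂ν) atTop (𝓝 (∫ x, g x ∂ν)) := by
  have hgm : AEStronglyMeasurable g ν := aestronglyMeasurable_of_tendsto_ae atTop hf hfg
  have hg2 : MemLp g 2 ν := memLp_two_of_lintegral_enorm_sq_le hgm
    (lintegral_enorm_sq_le_of_ae_tendsto hf hK hfg)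
  have hg1 : MemLp g 1 ν := hg2.mono_exponent (by norm_num)
  have hf1 : ∀ n, Integrable (f n) ν := fun n =>
    (memLp_two_of_lintegral_enorm_sq_le (hf n) (hK n)).integrable (by norm_num)
  have hui : UnifIntegrable f 1 ν := by
    refine unifIntegrable_of le_rfl (by simp) hf fun ε hε => ?_
    refine ⟨K / ε.toNNReal + 1, fun n => ?_⟩
    set C : NNReal := K / ε.toNNReal + 1
    have hC : (C : ENNReal) ≠ 0 := by simp [C]
    have hε' : 0 < ε.toNNReal := by simpa using hε
    rw [eLpNorm_one_eq_lintegral_enorm]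
    calc ∫⁻ x, ‖{ x | C ≤ ‖f n x‖₊ }.indicator (f n) x‖ₑ ∂ν
        ≤ ∫⁻ x, (C : ENNReal)⁻¹ * ‖f n x‖ₑ ^ 2 ∂ν := by
          refine lintegral_mono fun x => ?_
          by_cases hx : C ≤ ‖f n x‖₊
          · rw [Set.indicator_of_mem (by exact hx), mul_comm, ← div_eq_mul_inv,
              ENNReal.le_div_iff_mul_le (.inl hC) (.inl ENNReal.coe_ne_top), sq]
            gcongr
            simpa [enorm] using hx
          · rw [Set.indicator_of_notMem (by exact hx)]
            simp
      _ = (C : ENNReal)⁻¹ * ∫⁻ x, ‖f n x‖ₑ ^ 2 ∂ν :=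
          lintegral_const_mul' _ _ (by simpa using hC)
      _ ≤ (C : ENNReal)⁻¹ * K := by gcongr; exact hK n
      _ ≤ ENNReal.ofReal ε := by
          rw [mul_comm, ← div_eq_mul_inv]
          refine ENNReal.div_le_of_le_mul ?_
          rw [ENNReal.ofReal, ← ENNReal.coe_mul]
          refine ENNReal.coe_le_coe.2 ?_
          simp only [C, mul_add, mul_one]
          rw [mul_div_cancel₀ _ hε'.ne']
          exact le_self_add
  have h := tendsto_Lp_finite_of_tendsto_ae le_rfl (by simp) hf hg1 hui hfg
  refine tendsto_integral_of_L1' g hgm (.of_forall hf1) h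

end SecondMomentBound

section CameronMartinTheorem

variable {H : Type*} [NormedAddCommGroup H] [InnerProductSpace ℝ H] [CompleteSpace H]
  [SecondCountableTopology H] [MeasurableSpace H] [BorelSpace H]

/-- Two probability measures with the same finite Laplace transform are equal. -/
theorem measure_ext_of_mgf_inner {ν ν' : Measure H} [IsProbabilityMeasure ν]
    [IsProbabilityMeasure ν']
    (hint : ∀ t : H, Integrable (fun ξ => Real.exp (inner ℝ t ξ)) ν)
    (h : ∀ t : H, ∫ ξ, Real.exp (inner ℝ t ξ) ∂ν = ∫ ξ, Real.exp (inner ℝ t ξ) ∂ν') :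
    ν = ν' := by
  refine Measure.ext_of_charFun (funext fun t => ?_)
  have hm : mgf (fun ξ : H => inner ℝ t ξ) ν = mgf (fun ξ : H => inner ℝ t ξ) ν' := by
    ext s
    simpa [mgf, inner_smul_left] using h (s • t)
  have huniv : integrableExpSet (fun ξ : H => inner ℝ t ξ) ν = Set.univ := by
    ext s
    simpa [integrableExpSet, inner_smul_left] using hint (s • t)
  have := eqOn_complexMGF_of_mgf hm (x := Complex.I) (by simp [huniv])
  simpa [complexMGF, charFun_apply, real_inner_comm, mul_comm] using this

namespace IsCentredGaussian

variable {γ : Measure H} {C S : H →L[ℝ] H}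

theorem integral_inner_mul_inner (hγ : IsCentredGaussian γ C) (x y : H) :
    ∫ z, inner ℝ x z * inner ℝ y z ∂γ = inner ℝ (C x) y := by
  have := hγ.isGaussian
  rw [← hγ.covariance_eq, covarianceOperator_inner IsGaussian.memLp_two_id]

theorem integral_inner_sq (hγ : IsCentredGaussian γ C) (hS : S.IsPositive) (hSC : S ∘L S = C)
    (t : H) : ∫ z, inner ℝ t z ^ 2 ∂γ = ‖S t‖ ^ 2 := by
  have hsym : ∀ x y : H, inner ℝ (S x) y = inner ℝ x (S y) := hS.isSymmetric
  simp_rw [sq, hγ.integral_inner_mul_inner, ← hSC]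
  rw [ContinuousLinearMap.comp_apply, hsym, real_inner_self_eq_norm_mul_norm]

theorem map_inner (hγ : IsCentredGaussian γ C) (hS : S.IsPositive) (hSC : S ∘L S = C) (t : H) :
    γ.map (fun ξ => inner ℝ t ξ) = gaussianReal 0 (‖S t‖ ^ 2).toNNReal := by
  have := hγ.isGaussian
  have h := IsGaussian.map_eq_gaussianReal (μ := γ) (innerSL ℝ t)
  have h0 : ∫ ξ, inner ℝ t ξ ∂γ = 0 := by
    have := IsGaussian.integral_dual (μ := γ) (innerSL ℝ t)
    simpa [hγ.mean_eq_zero] using this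
  have hv : Var[fun ξ => inner ℝ t ξ; γ] = ‖S t‖ ^ 2 := by
    rw [variance_of_integral_eq_zero (by fun_prop) h0, hγ.integral_inner_sq hS hSC]
  simpa [h0, hv] using h

theorem integrable_exp_inner (hγ : IsCentredGaussian γ C) (hS : S.IsPositive)
    (hSC : S ∘L S = C) (t : H) : Integrable (fun ξ => Real.exp (inner ℝ t ξ)) γ := by
  have h := integrable_exp_mul_gaussianReal (μ := 0) (v := (‖S t‖ ^ 2).toNNReal) 1
  rw [← hγ.map_inner hS hSC, integrable_map_measure (by fun_prop) (by fun_prop)] at h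
  simpa [Function.comp_def] using h

theorem integral_exp_inner (hγ : IsCentredGaussian γ C) (hS : S.IsPositive)
    (hSC : S ∘L S = C) (t : H) : ∫ ξ, Real.exp (inner ℝ t ξ) ∂γ = Real.exp (‖S t‖ ^ 2 / 2) := by
  have h := mgf_gaussianReal (hγ.map_inner hS hSC t) 1
  simpa [mgf, sq_nonneg] using h

theorem eLpNorm_inner (hγ : IsCentredGaussian γ C) (hS : S.IsPositive)
    (hSC : S ∘L S = C) (t : H) :
    eLpNorm (fun ξ => inner ℝ t ξ) 2 γ = ENNReal.ofReal ‖S t‖ := by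
  have := hγ.isGaussian
  have hm : MemLp (fun ξ => inner ℝ t ξ) 2 γ := IsGaussian.memLp_dual γ (innerSL ℝ t) 2 (by simp)
  rw [hm.eLpNorm_eq_integral_rpow_norm (by simp) (by simp)]
  simp only [ENNReal.toReal_ofNat, Real.rpow_ofNat, Real.norm_eq_abs, sq_abs]
  rw [hγ.integral_inner_sq hS hSC, ← Real.rpow_natCast, ← Real.rpow_mul (norm_nonneg _)]
  norm_num

/-- For `y ∈ (ker S)ᗮ` there is a Gaussian functional `W`, formally `W ξ = ⟪S⁻¹ y, ξ⟫`. -/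
theorem exists_whiteNoise (hγ : IsCentredGaussian γ C) (hS : S.IsPositive)
    (hSC : S ∘L S = C) {y : H} (hy : y ∈ S.kerᗮ) :
    ∃ W : H → ℝ, Measurable W ∧ ∀ (t : H) (s : ℝ),
      Integrable (fun ξ => Real.exp (inner ℝ t ξ + s * W ξ)) γ ∧
      ∫ ξ, Real.exp (inner ℝ t ξ + s * W ξ) ∂γ = Real.exp (‖S t + s • y‖ ^ 2 / 2) := by
  have := hγ.isGaussian
  have hy' : y ∈ closure (Set.range S) := by
    rw [S.orthogonal_ker, hS.isSelfAdjoint.adjoint_eq] at hy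
    exact hy
  have hz : ∀ n : ℕ, ∃ z : H, ‖S z - y‖ < (1 / 2) ^ n / 4 := fun n => by
    obtain ⟨_, ⟨z, rfl⟩, hz⟩ := Metric.mem_closure_iff.1 hy' ((1 / 2) ^ n / 4) (by positivity)
    exact ⟨z, by rwa [dist_comm, dist_eq_norm] at hz⟩
  choose z hz using hz
  have hzlim : Tendsto (fun n => S (z n)) atTop (𝓝 y) := by
    rw [tendsto_iff_norm_sub_tendsto_zero]
    refine squeeze_zero (fun _ => norm_nonneg _) (fun n => (hz n).le) ?_
    simpa using (tendsto_pow_atTop_nhds_zero_of_lt_one (r := (1 / 2 : ℝ)) (by norm_num)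
      (by norm_num)).div_const 4
  have hmeas : ∀ n, Measurable fun ξ : H => inner ℝ (z n) ξ := fun n => by fun_prop
  have hcau : ∀ N n m : ℕ, N ≤ n → N ≤ m →
      eLpNorm ((fun ξ => inner ℝ (z n) ξ) - fun ξ => inner ℝ (z m) ξ) 2 γ
        < ENNReal.ofReal ((1 / 2) ^ N) := by
    intro N n m hn hm
    have : ((fun ξ => inner ℝ (z n) ξ) - fun ξ => inner ℝ (z m) ξ) =
        fun ξ : H => inner ℝ (z n - z m) ξ := by
      ext ξ
      simp [inner_sub_left]
    rw [this, hγ.eLpNorm_inner hS hSC]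
    refine (ENNReal.ofReal_lt_ofReal_iff (by positivity)).2 ?_
    have h1 : (1 / 2 : ℝ) ^ n ≤ (1 / 2) ^ N := pow_le_pow_of_le_one (by norm_num) (by norm_num) hn
    have h2 : (1 / 2 : ℝ) ^ m ≤ (1 / 2) ^ N := pow_le_pow_of_le_one (by norm_num) (by norm_num) hm
    have h3 : (0 : ℝ) < (1 / 2) ^ N := by positivity
    calc ‖S (z n - z m)‖ = ‖(S (z n) - y) - (S (z m) - y)‖ := by rw [map_sub]; congr 1; abel
      _ ≤ ‖S (z n) - y‖ + ‖S (z m) - y‖ := norm_sub_le _ _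
      _ < (1 / 2) ^ N := by linarith [hz n, hz m]
  have hsum : ∑' i : ℕ, ENNReal.ofReal ((1 / 2 : ℝ) ^ i) ≠ ⊤ :=
    (summable_geometric_of_lt_one (by norm_num) (by norm_num)).tsum_ofReal_ne_top
  obtain ⟨W, hWm, hW⟩ := exists_stronglyMeasurable_limit_of_tendsto_ae
    (fun n => (hmeas n).aestronglyMeasurable)
    (Lp.ae_tendsto_of_cauchy_eLpNorm (fun n => (hmeas n).aestronglyMeasurable) (by norm_num)
      hsum hcau)
  refine ⟨W, hWm.measurable, fun t s => ?_⟩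
  have hexp : ∀ n ξ, Real.exp (inner ℝ t ξ + s * inner ℝ (z n) ξ)
      = Real.exp (inner ℝ (t + s • z n) ξ) := fun n ξ => by
    simp [inner_add_left, inner_smul_left]
  have hlim : Tendsto (fun n => S t + s • S (z n)) atTop (𝓝 (S t + s • y)) :=
    (hzlim.const_smul s).const_add _
  have hfm : ∀ n, AEStronglyMeasurable
      (fun ξ => Real.exp (inner ℝ t ξ + s * inner ℝ (z n) ξ)) γ := fun n =>
    (by fun_prop : Measurable _).aestronglyMeasurable
  have hae : ∀ᵐ ξ ∂γ, Tendsto (fun n => Real.exp (inner ℝ t ξ + s * inner ℝ (z n) ξ)) atTop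
      (𝓝 (Real.exp (inner ℝ t ξ + s * W ξ))) := by
    filter_upwards [hW] with ξ hξ
    exact (Real.continuous_exp.tendsto _).comp ((hξ.const_mul s).const_add _)
  obtain ⟨R, hR⟩ := hlim.norm.bddAbove_range
  have hK : ∀ n, ∫⁻ ξ, ‖Real.exp (inner ℝ t ξ + s * inner ℝ (z n) ξ)‖ₑ ^ 2 ∂γ ≤
      (Real.exp (2 * R ^ 2)).toNNReal := by
    intro n
    have h1 : ∀ ξ : H, ‖Real.exp (inner ℝ t ξ + s * inner ℝ (z n) ξ)‖ₑ ^ 2 =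
        ENNReal.ofReal (Real.exp (inner ℝ ((2 : ℝ) • (t + s • z n)) ξ)) := fun ξ => by
      rw [hexp, Real.enorm_eq_ofReal (Real.exp_pos _).le, ← ENNReal.ofReal_pow (Real.exp_pos _).le,
        ← Real.exp_nat_mul, inner_smul_left]
      simp
    simp_rw [h1]
    rw [← ofReal_integral_eq_lintegral_ofReal (hγ.integrable_exp_inner hS hSC _)
      (.of_forall fun _ => (Real.exp_pos _).le), hγ.integral_exp_inner hS hSC, ENNReal.ofReal]
    refine ENNReal.coe_le_coe.2 (Real.toNNReal_le_toNNReal (Real.exp_le_exp.2 ?_))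
    have h2 : ‖S t + s • S (z n)‖ ≤ R := hR ⟨n, rfl⟩
    have h3 : S ((2 : ℝ) • (t + s • z n)) = (2 : ℝ) • (S t + s • S (z n)) := by simp
    rw [h3, norm_smul]
    have h4 : ‖S t + s • S (z n)‖ ^ 2 ≤ R ^ 2 := by gcongr
    norm_num [mul_pow]
    linarith
  constructor
  · exact (memLp_two_of_lintegral_enorm_sq_le (aestronglyMeasurable_of_tendsto_ae atTop hfm hae)
      (lintegral_enorm_sq_le_of_ae_tendsto hfm hK hae)).integrable (by norm_num)
  · refine tendsto_nhds_unique (tendsto_integral_of_lintegral_enorm_sq_le hfm hK hae) ?_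
    simp_rw [hexp, hγ.integral_exp_inner hS hSC, map_add, map_smul]
    exact (Real.continuous_exp.tendsto _).comp ((hlim.norm.pow 2).div_const 2)

/-- The Cameron–Martin theorem: a shift of a Gaussian measure by `S y` has an exponential
density. The last two clauses are the first moment of the exponent under the shifted measure. -/
theorem exists_map_add_eq_withDensity (hγ : IsCentredGaussian γ C) (hS : S.IsPositive)
    (hSC : S ∘L S = C) {y : H} (hy : y ∈ S.kerᗮ) :
    ∃ W : H → ℝ, Measurable W ∧
      γ.map (fun ξ => S y + ξ) =
        γ.withDensity (fun ξ => ENNReal.ofReal (Real.exp (W ξ - ‖y‖ ^ 2 / 2))) ∧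
      Integrable W (γ.map (fun ξ => S y + ξ)) ∧
      ∫ ξ, W ξ ∂(γ.map (fun ξ => S y + ξ)) = ‖y‖ ^ 2 := by
  have := hγ.isGaussian
  have hsym : ∀ x y : H, inner ℝ (S x) y = inner ℝ x (S y) := hS.isSymmetric
  obtain ⟨W, hWm, hW⟩ := hγ.exists_whiteNoise hS hSC hy
  have hmgf : mgf W γ = fun s => Real.exp (s ^ 2 * ‖y‖ ^ 2 / 2) := by
    ext s
    have := (hW 0 s).2
    simpa [mgf, norm_smul, mul_pow] using this
  have hset : integrableExpSet W γ = Set.univ := by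
    ext s
    have := (hW 0 s).1
    simpa [integrableExpSet] using this
  have htilt : γ.tilted (fun ξ => 1 * W ξ) =
      γ.withDensity (fun ξ => ENNReal.ofReal (Real.exp (W ξ - ‖y‖ ^ 2 / 2))) := by
    have h1 : ∫ ξ, Real.exp (1 * W ξ) ∂γ = Real.exp (1 ^ 2 * ‖y‖ ^ 2 / 2) := congrFun hmgf 1
    simp only [one_mul, one_pow] at h1
    simp only [Measure.tilted, h1, Real.exp_sub, one_mul]
  have hint1 : Integrable (fun ξ => Real.exp (1 * W ξ)) γ := by
    have := (hW 0 1).1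
    simpa using this
  have hp1 : IsProbabilityMeasure (γ.tilted (fun ξ => 1 * W ξ)) := isProbabilityMeasure_tilted hint1
  have hp2 : IsProbabilityMeasure (γ.map (fun ξ => S y + ξ)) :=
    Measure.isProbabilityMeasure_map (by fun_prop)
  have hmap : ∀ t : H, ∀ ξ, Real.exp (inner ℝ t (S y + ξ)) =
      Real.exp (inner ℝ (S t) y) * Real.exp (inner ℝ t ξ) := fun t ξ => by
    rw [inner_add_right, Real.exp_add, hsym]
  have heq : γ.map (fun ξ => S y + ξ) = γ.tilted (fun ξ => 1 * W ξ) := by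
    refine measure_ext_of_mgf_inner (fun t => ?_) (fun t => ?_)
    · rw [integrable_map_measure (by fun_prop) (by fun_prop), Function.comp_def]
      simp_rw [hmap]
      exact (hγ.integrable_exp_inner hS hSC t).const_mul _
    · rw [integral_map (by fun_prop) (by fun_prop)]
      simp_rw [hmap]
      rw [integral_const_mul, hγ.integral_exp_inner hS hSC, integral_tilted_mul_eq_mgf, hmgf]
      have h1 : ∀ ξ, (Real.exp (1 * W ξ) / Real.exp (1 ^ 2 * ‖y‖ ^ 2 / 2)) •
          Real.exp (inner ℝ t ξ) =
          Real.exp (inner ℝ t ξ + 1 * W ξ) * Real.exp (-(1 ^ 2 * ‖y‖ ^ 2 / 2)) := fun ξ => by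
        rw [smul_eq_mul, Real.exp_neg, Real.exp_add]
        field_simp
      simp_rw [h1]
      rw [integral_mul_const, (hW t 1).2, ← Real.exp_add, ← Real.exp_add, one_smul,
        norm_add_sq_real]
      congr 1
      ring
  have hmem : (1 : ℝ) ∈ interior (integrableExpSet W γ) := by simp [hset]
  refine ⟨W, hWm, heq.trans htilt, ?_, ?_⟩
  · rw [heq]
    exact (memLp_tilted_mul hmem 1).integrable (by simp)
  · rw [heq, integral_tilted_mul_self hmem]
    have : cgf W γ = fun s => s ^ 2 * ‖y‖ ^ 2 / 2 := by
      ext s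
      rw [cgf, hmgf, Real.log_exp]
    rw [this]
    have hd : HasDerivAt (fun s : ℝ => s ^ 2 * ‖y‖ ^ 2 / 2) (2 * 1 * ‖y‖ ^ 2 / 2) 1 := by
      simpa using (((hasDerivAt_id (1 : ℝ)).pow 2).mul_const (‖y‖ ^ 2)).div_const 2
    rw [hd.deriv]
    ring

end IsCentredGaussian

end CameronMartinTheorem

section KullbackLeibler

theorem llr_withDensity_withDensity {α : Type*} [MeasurableSpace α] (ρ : Measure α) {D p : α → ℝ}
    (hD : Measurable D) (hp : Measurable p) (hD0 : ∀ u, 0 < D u) (hp0 : ∀ u, 0 < p u)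
    {ν μ : Measure α} [IsFiniteMeasure μ]
    (hν : ν = ρ.withDensity fun u => ENNReal.ofReal (D u))
    (hμ : μ = ρ.withDensity fun u => ENNReal.ofReal (p u)) :
    ν ≪ μ ∧ llr ν μ =ᵐ[ν] fun u => Real.log (D u) - Real.log (p u) := by
  have hνμ : ν = μ.withDensity fun u => ENNReal.ofReal (D u / p u) := by
    rw [hμ, hν, ← withDensity_mul _ (by fun_prop) (by fun_prop)]
    congr 1
    ext u
    rw [Pi.mul_apply, ← ENNReal.ofReal_mul (hp0 u).le, mul_div_cancel₀ _ (hp0 u).ne']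
  have hac : ν ≪ μ := hνμ ▸ withDensity_absolutelyContinuous _ _
  refine ⟨hac, hac.ae_le ?_⟩
  have h := Measure.rnDeriv_withDensity μ
    (f := fun u => ENNReal.ofReal (D u / p u)) (by fun_prop)
  rw [← hνμ] at h
  filter_upwards [h] with u hu
  rw [llr, hu, ENNReal.toReal_ofReal (div_pos (hD0 u) (hp0 u)).le,
    Real.log_div (hD0 u).ne' (hp0 u).ne']

theorem integrable_gaussianWithMean_iff {H : Type*} [NormedAddCommGroup H] [MeasurableSpace H]
    [BorelSpace H] {γ : Measure H} {m₀ : H} {Φ : H → ℝ} (hΦ : Measurable Φ) (b : H) :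
    Integrable Φ (gaussianWithMean γ (m₀ + b)) ↔ Integrable (fun ξ => Φ (b + m₀ + ξ)) γ := by
  rw [gaussianWithMean, integrable_map_measure (by fun_prop) (by fun_prop), Function.comp_def]
  simp_rw [add_comm m₀ b]

variable {H : Type*} [NormedAddCommGroup H] [InnerProductSpace ℝ H] [CompleteSpace H]
  [SecondCountableTopology H] [MeasurableSpace H] [BorelSpace H]
  {γ : Measure H} {C₀ S : H →L[ℝ] H} {m₀ : H} {Φ : H → ℝ} {Z : ℝ} {μ : Measure H}

theorem llr_gaussianWithMean [IsProbabilityMeasure μ] (hγ : IsCentredGaussian γ C₀)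
    (hS : S.IsPositive) (hSC : S ∘L S = C₀) (hΦ : Measurable Φ) (hZ : 0 < Z)
    (hμ : μ = (gaussianWithMean γ m₀).withDensity
      fun u => ENNReal.ofReal (Real.exp (-Φ u) / Z)) (x : CameronMartin S) :
    gaussianWithMean γ (m₀ + CameronMartin.incl S x) ≪ μ ∧
    ∃ V : H → ℝ, Integrable V (gaussianWithMean γ (m₀ + CameronMartin.incl S x)) ∧
      ∫ u, V u ∂(gaussianWithMean γ (m₀ + CameronMartin.incl S x)) = ‖x‖ ^ 2 ∧
      llr (gaussianWithMean γ (m₀ + CameronMartin.incl S x)) μ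
        =ᵐ[gaussianWithMean γ (m₀ + CameronMartin.incl S x)]
        fun u => V u - ‖x‖ ^ 2 / 2 + Φ u + Real.log Z := by
  have := hγ.isGaussian
  obtain ⟨W, hWm, hW1, hW2, hW3⟩ :=
    hγ.exists_map_add_eq_withDensity hS hSC (CameronMartin.inv S x).2
  rw [← CameronMartin.incl_eq] at hW1 hW2 hW3
  set b := CameronMartin.incl S x
  have hmap : gaussianWithMean γ (m₀ + b) = (γ.map fun ξ => b + ξ).map fun ξ => m₀ + ξ := by
    rw [Measure.map_map (by fun_prop) (by fun_prop), gaussianWithMean]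
    congr 1
    ext ξ
    simp [add_assoc]
  have hD : gaussianWithMean γ (m₀ + b) = (gaussianWithMean γ m₀).withDensity
      fun u => ENNReal.ofReal (Real.exp (W (u - m₀) - ‖x‖ ^ 2 / 2)) := by
    rw [hmap, hW1, ← CameronMartin.norm_def, gaussianWithMean]
    ext s hs
    have hms : MeasurableSet ((fun ξ => m₀ + ξ) ⁻¹' s) := hs.preimage (by fun_prop)
    rw [Measure.map_apply (by fun_prop) hs, withDensity_apply _ hms, withDensity_apply _ hs,
      setLIntegral_map hs (by fun_prop) (by fun_prop)]
    simp
  obtain ⟨hac, hllr⟩ := llr_withDensity_withDensity _ (by fun_prop) (by fun_prop)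
    (fun _ => Real.exp_pos _) (fun u => div_pos (Real.exp_pos (-Φ u)) hZ) hD hμ
  have hWm' : Measurable fun u => W (u - m₀) := by fun_prop
  refine ⟨hac, fun u => W (u - m₀), ?_, ?_, ?_⟩
  · rw [hmap, integrable_map_measure hWm'.aestronglyMeasurable (by fun_prop)]
    simpa [Function.comp_def] using hW2
  · rw [hmap, integral_map (by fun_prop) hWm'.aestronglyMeasurable]
    simpa [← CameronMartin.norm_def] using hW3
  · filter_upwards [hllr] with u hu
    rw [hu, Real.log_exp, Real.log_div (Real.exp_pos _).ne' hZ.ne', Real.log_exp]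
    ring

/-- The relative entropy `R(N(m₀ + x, C₀) ‖ μ)` is finite only if `Φ` is integrable. -/
theorem integrable_of_relEntropy_ne_top [IsProbabilityMeasure μ] (hγ : IsCentredGaussian γ C₀)
    (hS : S.IsPositive) (hSC : S ∘L S = C₀) (hΦ : Measurable Φ) (hZ : 0 < Z)
    (hμ : μ = (gaussianWithMean γ m₀).withDensity
      fun u => ENNReal.ofReal (Real.exp (-Φ u) / Z)) {x : CameronMartin S}
    (hx : relEntropy S γ μ m₀ x ≠ ⊤) :
    Integrable (fun ξ => Φ (CameronMartin.incl S x + m₀ + ξ)) γ := by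
  have := hγ.isGaussian
  have : IsProbabilityMeasure (gaussianWithMean γ (m₀ + CameronMartin.incl S x)) :=
    Measure.isProbabilityMeasure_map (by fun_prop)
  obtain ⟨-, V, hV, -, hllr⟩ := llr_gaussianWithMean hγ hS hSC hΦ hZ hμ x
  rw [← integrable_gaussianWithMean_iff hΦ]
  have h1 := (integrable_congr hllr).1 (InformationTheory.klDiv_ne_top_iff.1 hx).2
  have h2 := (h1.sub (integrable_const (Real.log Z))).sub (hV.sub (integrable_const (‖x‖ ^ 2 / 2)))
  refine h2.congr (.of_forall fun u => ?_)
  simp only [Pi.sub_apply]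
  ring

/-- The relative entropy `R(N(m₀ + x, C₀) ‖ μ)` is `𝔼 Φ(x + m₀ + ξ) + ‖x‖² / 2 + log Z`. -/
theorem objective_eq [IsProbabilityMeasure μ] (hγ : IsCentredGaussian γ C₀)
    (hS : S.IsPositive) (hSC : S ∘L S = C₀) (hΦ : Measurable Φ) (hZ : 0 < Z)
    (hμ : μ = (gaussianWithMean γ m₀).withDensity
      fun u => ENNReal.ofReal (Real.exp (-Φ u) / Z)) {x : CameronMartin S}
    (hx : Integrable (fun ξ => Φ (CameronMartin.incl S x + m₀ + ξ)) γ) :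
    objective S γ μ m₀ x =
      ∫ ξ, Φ (CameronMartin.incl S x + m₀ + ξ) ∂γ + ‖x‖ ^ 2 / 2 + Real.log Z := by
  have := hγ.isGaussian
  have : IsProbabilityMeasure (gaussianWithMean γ (m₀ + CameronMartin.incl S x)) :=
    Measure.isProbabilityMeasure_map (by fun_prop)
  obtain ⟨hac, V, hV, hV', hllr⟩ := llr_gaussianWithMean hγ hS hSC hΦ hZ hμ x
  have hx' := (integrable_gaussianWithMean_iff hΦ _).2 hx
  have h2 : Integrable (fun u => V u - ‖x‖ ^ 2 / 2)
      (gaussianWithMean γ (m₀ + CameronMartin.incl S x)) := hV.sub (integrable_const _)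
  have h3 : Integrable (fun u => V u - ‖x‖ ^ 2 / 2 + Φ u)
      (gaussianWithMean γ (m₀ + CameronMartin.incl S x)) := h2.add hx'
  rw [objective, relEntropy, InformationTheory.toReal_klDiv_of_measure_eq hac (by simp),
    integral_congr_ae hllr, integral_add h3 (integrable_const _), integral_add h2 hx',
    integral_sub hV (integrable_const _), hV']
  have h1 : ∫ u, Φ u ∂(gaussianWithMean γ (m₀ + CameronMartin.incl S x)) =
      ∫ ξ, Φ (CameronMartin.incl S x + m₀ + ξ) ∂γ := by
    rw [gaussianWithMean, integral_map (by fun_prop) (by fun_prop)]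
    simp_rw [add_comm m₀]
  rw [h1]
  simp
  ring

end KullbackLeibler

section WeakMeasurability

variable {E : Type*} [NormedAddCommGroup E] [InnerProductSpace ℝ E]
  [SecondCountableTopology E] [MeasurableSpace E] [BorelSpace E]

theorem measurable_of_forall_measurable_inner {α : Type*} [MeasurableSpace α] {f : α → E}
    (hf : ∀ e : E, Measurable fun a => inner ℝ e (f a)) : Measurable f := by
  have hnorm : ∀ c : E, Measurable fun a => ‖f a - c‖ := by
    refine fun c => measurable_of_Iic fun r => ?_
    by_cases hr : r < 0
    · convert MeasurableSet.empty
      ext a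
      simpa using hr.trans_le (norm_nonneg _)
    have : (fun a => ‖f a - c‖) ⁻¹' Set.Iic r =
        ⋂ n, {a | inner ℝ (TopologicalSpace.denseSeq E n) (f a - c) ≤
          r * ‖TopologicalSpace.denseSeq E n‖} := by
      ext a
      simp only [Set.mem_preimage, Set.mem_Iic, Set.mem_iInter, Set.mem_ofPred_eq]
      refine ⟨fun h n => (real_inner_le_norm _ _).trans ?_, fun h => ?_⟩
      · rw [mul_comm]
        gcongr
      · have hcl : IsClosed {d : E | inner ℝ d (f a - c) ≤ r * ‖d‖} :=
          isClosed_le (by fun_prop) (by fun_prop)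
        have h2 : f a - c ∈ {d : E | inner ℝ d (f a - c) ≤ r * ‖d‖} :=
          hcl.closure_subset_iff.2 (Set.range_subset_iff.2 h)
            (TopologicalSpace.denseRange_denseSeq E (f a - c))
        rw [Set.mem_ofPred_eq, real_inner_self_eq_norm_sq] at h2
        nlinarith [norm_nonneg (f a - c)]
    rw [this]
    refine MeasurableSet.iInter fun n => measurableSet_le ?_ measurable_const
    simp_rw [inner_sub_right]
    exact (hf _).sub_const _
  refine measurable_of_isOpen fun U hU => ?_
  have hball : ∀ x : U, ∃ ε > 0, Metric.ball (x : E) ε ⊆ U := fun x =>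
    Metric.isOpen_iff.1 hU x x.2
  choose ε hε hεU using hball
  obtain ⟨T, hT, hTU⟩ := TopologicalSpace.isOpen_iUnion_countable
    (fun x : U => Metric.ball (x : E) (ε x)) fun x => Metric.isOpen_ball
  have hUeq : U = ⋃ x ∈ T, Metric.ball (x : E) (ε x) := by
    rw [hTU]
    refine Set.Subset.antisymm (fun x hx => ?_) (Set.iUnion_subset hεU)
    exact Set.mem_iUnion.2 ⟨⟨x, hx⟩, Metric.mem_ball_self (hε _)⟩
  rw [hUeq, Set.preimage_iUnion₂]
  refine MeasurableSet.biUnion hT fun x _ => ?_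
  have : f ⁻¹' Metric.ball (x : E) (ε x) = {a | ‖f a - x‖ < ε x} := by
    ext a
    simp [dist_eq_norm]
  rw [this]
  exact measurableSet_lt (hnorm _) measurable_const

variable [CompleteSpace E] {Ξ : Type*} [MeasurableSpace Ξ] {γ : Measure Ξ}

/-- The partial gradient of a jointly measurable function has a jointly measurable version. -/
theorem exists_measurable_gradient {φ : E → Ξ → ℝ}
    (hφ : Measurable fun p : E × Ξ => φ p.1 p.2)
    (hd : ∀ᵐ ξ ∂γ, Differentiable ℝ (fun x => φ x ξ)) :
    ∃ g : E × Ξ → E, Measurable g ∧ ∀ᵐ ξ ∂γ, ∀ x, g (x, ξ) = gradient (fun x => φ x ξ) x := by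
  classical
  set N := toMeasurable γ {ξ | ¬ Differentiable ℝ fun x => φ x ξ}
  have hN : MeasurableSet N := measurableSet_toMeasurable _ _
  have hN0 : γ N = 0 := by rw [measure_toMeasurable]; exact hd
  have hNd : ∀ ξ ∉ N, Differentiable ℝ fun x => φ x ξ := fun ξ hξ => by
    by_contra h
    exact hξ (subset_toMeasurable _ _ h)
  refine ⟨fun p => if p.2 ∈ N then 0 else gradient (fun x => φ x p.2) p.1,
    measurable_of_forall_measurable_inner fun e => ?_, ?_⟩
  · refine measurable_of_tendsto_metrizable
      (f := fun (n : ℕ) (p : E × Ξ) => if p.2 ∈ N then 0 else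
        (n : ℝ) • (φ (p.1 + (n : ℝ)⁻¹ • e) p.2 - φ p.1 p.2)) (fun n => ?_) ?_
    · refine Measurable.ite (hN.preimage measurable_snd) measurable_const ?_
      have h1 : Measurable fun p : E × Ξ => φ (p.1 + (n : ℝ)⁻¹ • e) p.2 :=
        hφ.comp ((measurable_fst.add_const _).prodMk measurable_snd)
      exact (h1.sub hφ).const_smul (n : ℝ)
    · rw [tendsto_pi_nhds]
      rintro ⟨x, ξ⟩
      by_cases hξ : ξ ∈ N
      · simp [hξ]
      · simp only [hξ, if_false]
        have h := ((hNd ξ hξ x).hasFDerivAt.lim e (c := fun n : ℕ => (n : ℝ)) (l := atTop)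
          (by simpa using tendsto_natCast_atTop_atTop))
        rw [← toDual_gradient] at h
        simpa [real_inner_comm] using h
  · filter_upwards [measure_eq_zero_iff_ae_notMem.1 hN0] with ξ hξ x
    simp [hξ]

end WeakMeasurability

section ParametricGradient

theorem sub_eq_integral_inner {E : Type*} [NormedAddCommGroup E] [InnerProductSpace ℝ E]
    [CompleteSpace E] {Ξ : Type*} [MeasurableSpace Ξ] {γ : Measure Ξ} {φ : E → Ξ → ℝ}
    {g : E × Ξ → E} (hg : ∀ᵐ ξ ∂γ, ∀ x, HasGradientAt (fun x => φ x ξ) (g (x, ξ)) x)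
    (hgc : ∀ᵐ ξ ∂γ, Continuous fun x => g (x, ξ)) (x d : E) :
    ∀ᵐ ξ ∂γ, φ (x + d) ξ - φ x ξ = ∫ t in Set.Ioc (0 : ℝ) 1, inner ℝ (g (x + t • d, ξ)) d := by
  filter_upwards [hg, hgc] with ξ hξ hξc
  rw [← intervalIntegral.integral_of_le zero_le_one,
    intervalIntegral.integral_eq_sub_of_hasDerivAt (f := fun t : ℝ => φ (x + t • d) ξ)]
  · simp
  · intro t _
    have h1 : HasDerivAt (fun t : ℝ => x + t • d) d t := by
      simpa using ((hasDerivAt_id t).smul_const d).const_add x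
    have h2 := (hξ (x + t • d)).hasFDerivAt.comp_hasDerivAt t h1
    rw [InnerProductSpace.toDual_apply_apply] at h2
    exact h2
  · refine Continuous.intervalIntegrable ?_ _ _
    have : Continuous fun t : ℝ => g (x + t • d, ξ) := hξc.comp (by fun_prop)
    exact this.inner continuous_const

theorem integrable_of_bounded_sq {E : Type*} [NormedAddCommGroup E]
    [SecondCountableTopology E] [MeasurableSpace E] [BorelSpace E] {Ξ : Type*} [MeasurableSpace Ξ]
    {γ : Measure Ξ} [IsProbabilityMeasure γ] {g : E × Ξ → E} (hgm : Measurable g)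
    (hb : ∀ B : Set E, Bornology.IsBounded B → ∃ K : NNReal, ∀ x ∈ B,
      ∫⁻ ξ, ‖g (x, ξ)‖ₑ ^ 2 ∂γ ≤ K) (x : E) : Integrable (fun ξ => g (x, ξ)) γ := by
  obtain ⟨K, hK⟩ := hb {x} Bornology.isBounded_singleton
  exact (memLp_two_of_lintegral_enorm_sq_le
    (hgm.comp measurable_prodMk_left).aestronglyMeasurable (hK x rfl)).integrable (by norm_num)

variable {E : Type*} [NormedAddCommGroup E] [InnerProductSpace ℝ E]
  [SecondCountableTopology E] [MeasurableSpace E] [BorelSpace E]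
  {Ξ : Type*} [MeasurableSpace Ξ] {γ : Measure Ξ} [IsProbabilityMeasure γ]
  {φ : E → Ξ → ℝ} {g : E × Ξ → E}

theorem continuous_integral_of_bounded_sq (hgm : Measurable g)
    (hgc : ∀ᵐ ξ ∂γ, Continuous fun x => g (x, ξ))
    (hb : ∀ B : Set E, Bornology.IsBounded B → ∃ K : NNReal, ∀ x ∈ B,
      ∫⁻ ξ, ‖g (x, ξ)‖ₑ ^ 2 ∂γ ≤ K) :
    Continuous fun x => ∫ ξ, g (x, ξ) ∂γ := by
  refine continuous_iff_seqContinuous.2 fun u x hu => ?_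
  obtain ⟨K, hK⟩ := hb _ (Metric.isBounded_range_of_tendsto u hu)
  refine tendsto_integral_of_lintegral_enorm_sq_le (K := K)
    (fun n => (hgm.comp measurable_prodMk_left).aestronglyMeasurable)
    (fun n => hK _ ⟨n, rfl⟩) ?_
  filter_upwards [hgc] with ξ hξ
  exact (hξ.tendsto x).comp hu

theorem integrable_inner_segment (hgm : Measurable g)
    (hb : ∀ B : Set E, Bornology.IsBounded B → ∃ K : NNReal, ∀ x ∈ B,
      ∫⁻ ξ, ‖g (x, ξ)‖ₑ ^ 2 ∂γ ≤ K) (x d : E) :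
    Integrable (fun p : ℝ × Ξ => inner ℝ (g (x + p.1 • d, p.2)) d)
      ((volume.restrict (Set.Ioc 0 1)).prod γ) := by
  obtain ⟨K, hK⟩ := hb (Metric.closedBall x ‖d‖) Metric.isBounded_closedBall
  have hm : Measurable fun p : ℝ × Ξ => g (x + p.1 • d, p.2) :=
    hgm.comp (by fun_prop)
  refine Integrable.inner_const ?_ d
  refine (memLp_two_of_lintegral_enorm_sq_le (K := K) hm.aestronglyMeasurable ?_).integrable
    (by norm_num)
  rw [lintegral_prod _ (by fun_prop)]
  calc ∫⁻ t in Set.Ioc (0 : ℝ) 1, ∫⁻ ξ, ‖g (x + t • d, ξ)‖ₑ ^ 2 ∂γ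
      ≤ ∫⁻ t in Set.Ioc (0 : ℝ) 1, K := by
        refine setLIntegral_mono measurable_const fun t ht => hK _ ?_
        rw [Metric.mem_closedBall, dist_self_add_left, norm_smul, Real.norm_eq_abs,
          abs_of_pos ht.1]
        exact mul_le_of_le_one_left (norm_nonneg _) ht.2
    _ = K := by simp

variable [CompleteSpace E]

theorem integrable_add_iff_of_gradient (hgm : Measurable g)
    (hg : ∀ᵐ ξ ∂γ, ∀ x, HasGradientAt (fun x => φ x ξ) (g (x, ξ)) x)
    (hgc : ∀ᵐ ξ ∂γ, Continuous fun x => g (x, ξ))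
    (hb : ∀ B : Set E, Bornology.IsBounded B → ∃ K : NNReal, ∀ x ∈ B,
      ∫⁻ ξ, ‖g (x, ξ)‖ₑ ^ 2 ∂γ ≤ K) {x₀ : E} (h₀ : Integrable (φ x₀) γ) (x : E) :
    Integrable (φ x) γ := by
  have h1 := (integrable_inner_segment hgm hb x₀ (x - x₀)).integral_prod_right
  refine (h₀.add h1).congr ?_
  filter_upwards [sub_eq_integral_inner hg hgc x₀ (x - x₀)] with ξ hξ
  rw [Pi.add_apply, ← hξ]
  simp

theorem integral_sub_eq_integral_inner (hgm : Measurable g)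
    (hg : ∀ᵐ ξ ∂γ, ∀ x, HasGradientAt (fun x => φ x ξ) (g (x, ξ)) x)
    (hgc : ∀ᵐ ξ ∂γ, Continuous fun x => g (x, ξ))
    (hb : ∀ B : Set E, Bornology.IsBounded B → ∃ K : NNReal, ∀ x ∈ B,
      ∫⁻ ξ, ‖g (x, ξ)‖ₑ ^ 2 ∂γ ≤ K) (hφ : ∀ x, Integrable (φ x) γ) (x d : E) :
    ∫ ξ, φ (x + d) ξ ∂γ - ∫ ξ, φ x ξ ∂γ =
      ∫ t in (0 : ℝ)..1, inner ℝ (∫ ξ, g (x + t • d, ξ) ∂γ) d := by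
  rw [← integral_sub (hφ _) (hφ _), integral_congr_ae (sub_eq_integral_inner hg hgc x d),
    ← integral_integral_swap (integrable_inner_segment hgm hb x d),
    intervalIntegral.integral_of_le zero_le_one]
  refine integral_congr_ae (.of_forall fun t => ?_)
  simp_rw [real_inner_comm d]
  exact integral_inner (integrable_of_bounded_sq hgm hb _) d

/-- Differentiation under the integral sign, for gradients that are bounded in `L²` on bounded
sets. -/
theorem hasGradientAt_integral_of_bounded_sq (hgm : Measurable g)
    (hg : ∀ᵐ ξ ∂γ, ∀ x, HasGradientAt (fun x => φ x ξ) (g (x, ξ)) x)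
    (hgc : ∀ᵐ ξ ∂γ, Continuous fun x => g (x, ξ))
    (hb : ∀ B : Set E, Bornology.IsBounded B → ∃ K : NNReal, ∀ x ∈ B,
      ∫⁻ ξ, ‖g (x, ξ)‖ₑ ^ 2 ∂γ ≤ K) (hφ : ∀ x, Integrable (φ x) γ) (x : E) :
    HasGradientAt (fun x => ∫ ξ, φ x ξ ∂γ) (∫ ξ, g (x, ξ) ∂γ) x := by
  set G : E → E := fun x => ∫ ξ, g (x, ξ) ∂γ with hG
  have hGc : Continuous G := continuous_integral_of_bounded_sq hgm hgc hb
  rw [hasGradientAt_iff_hasFDerivAt, hasFDerivAt_iff_isLittleO_nhds_zero,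
    Asymptotics.isLittleO_iff]
  intro ε hε
  obtain ⟨δ, hδ, hball⟩ := Metric.continuousAt_iff.1 (hGc.continuousAt (x := x)) ε hε
  filter_upwards [Metric.ball_mem_nhds (0 : E) hδ] with d hd
  have hd' : ‖d‖ < δ := by simpa using hd
  have h1 : (∫ ξ, φ (x + d) ξ ∂γ) - (∫ ξ, φ x ξ ∂γ) -
      (InnerProductSpace.toDual ℝ E (G x)) d =
      ∫ t in (0 : ℝ)..1, inner ℝ (G (x + t • d) - G x) d := by
    rw [integral_sub_eq_integral_inner hgm hg hgc hb hφ]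
    simp_rw [inner_sub_left]
    rw [intervalIntegral.integral_sub]
    · simp [hG]
    · refine Continuous.intervalIntegrable ?_ _ _
      have : Continuous fun t : ℝ => G (x + t • d) := hGc.comp (by fun_prop)
      exact this.inner continuous_const
    · simp
  rw [h1]
  have h2 := intervalIntegral.norm_integral_le_of_norm_le_const (a := (0 : ℝ)) (b := 1)
    (f := fun t => inner ℝ (G (x + t • d) - G x) d) (C := ε * ‖d‖) fun t ht => ?_
  · simpa using h2
  rw [Set.uIoc_of_le zero_le_one] at ht
  refine (norm_inner_le_norm _ _).trans ?_
  gcongr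
  rw [← dist_eq_norm]
  refine (hball ?_).le
  rw [dist_self_add_left, norm_smul, Real.norm_eq_abs, abs_of_pos ht.1]
  exact (mul_le_of_le_one_left (norm_nonneg _) ht.2).trans_lt hd'

end ParametricGradient

section StrongConvexity

variable {E : Type*} [NormedAddCommGroup E] [InnerProductSpace ℝ E] [CompleteSpace E]

theorem mul_norm_sq_le_inner_sub {J : E → ℝ} {h : E → E} (hJ : ∀ x, HasGradientAt J (h x) x)
    {s : Set E} (hs : Convex ℝ s) {α : ℝ} (hα : 0 < α)
    (hcoer : ∀ x ∈ s, ∀ u : E, α * ‖u‖ ^ 2 ≤ fderiv ℝ (fderiv ℝ J) x u u)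
    {x y : E} (hx : x ∈ s) (hy : y ∈ s) :
    α * ‖x - y‖ ^ 2 ≤ inner ℝ (h x - h y) (x - y) := by
  rcases eq_or_ne x y with rfl | hxy
  · simp
  set d := x - y
  have hd : 0 < ‖d‖ := norm_pos_iff.2 (sub_ne_zero.2 hxy)
  have hdiff : ∀ z ∈ s, DifferentiableAt ℝ (fderiv ℝ J) z := fun z hz => by
    by_contra hz'
    have h1 := hcoer z hz d
    rw [fderiv_zero_of_not_differentiableAt hz'] at h1
    have : 0 < α * ‖d‖ ^ 2 := by positivity
    simp at h1
    linarith
  have hmem : ∀ t ∈ Set.Icc (0 : ℝ) 1, y + t • d ∈ s := fun t ht =>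
    hs.add_smul_sub_mem hy hx ht
  have hJ' : ∀ z, fderiv ℝ J z d = inner ℝ (h z) d := fun z => by
    rw [(hJ z).hasFDerivAt.fderiv]
    simp
  have hder : ∀ t ∈ Set.Icc (0 : ℝ) 1, HasDerivAt (fun t : ℝ => fderiv ℝ J (y + t • d) d)
      (fderiv ℝ (fderiv ℝ J) (y + t • d) d d) t := fun t ht => by
    have h1 : HasDerivAt (fun t : ℝ => y + t • d) d t := by
      simpa using ((hasDerivAt_id t).smul_const d).const_add y
    have h2 := (hdiff _ (hmem t ht)).hasFDerivAt.comp_hasDerivAt t h1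
    have h3 := h2.clm_apply (hasDerivAt_const t d)
    simpa using h3
  obtain ⟨c, hc, hc'⟩ := exists_hasDerivAt_eq_slope (fun t : ℝ => fderiv ℝ J (y + t • d) d)
    (fun t => fderiv ℝ (fderiv ℝ J) (y + t • d) d d) zero_lt_one
    (fun t ht => (hder t ht).continuousAt.continuousWithinAt)
    (fun t ht => hder t (Set.Ioo_subset_Icc_self ht))
  have h4 := hcoer _ (hmem c (Set.Ioo_subset_Icc_self hc)) d
  rw [hc'] at h4
  simpa [hJ', d, inner_sub_left] using h4

end StrongConvexity

section MartingaleNoise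

theorem integrable_inner_of_memLp_two {α E : Type*} [MeasurableSpace α] {ν : Measure α}
    [NormedAddCommGroup E] [InnerProductSpace ℝ E] {f g : α → E} (hf : MemLp f 2 ν)
    (hg : MemLp g 2 ν) : Integrable (fun x => inner ℝ (f x) (g x)) ν := by
  refine ((hf.integrable_norm_pow (by norm_num)).add
    (hg.integrable_norm_pow (by norm_num))).mono' (hf.1.inner hg.1) (.of_forall fun x => ?_)
  have h := norm_inner_le_norm (𝕜 := ℝ) (f x) (g x)
  simp only [Pi.add_apply]
  nlinarith [sq_nonneg (‖f x‖ - ‖g x‖), norm_nonneg (f x), norm_nonneg (g x)]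

variable {Ξ : Type*} [MeasurableSpace Ξ] {γ : Measure Ξ}
  {Ω : Type*} {m : MeasurableSpace Ω} [mΩ : MeasurableSpace Ω] {P : Measure Ω}
  [IsProbabilityMeasure P]

/-- The joint law of a sample and of a variable that is determined by the past. -/
theorem map_prodMk_eq_prod_of_indep {F : Type*} [MeasurableSpace F] (hm : m ≤ mΩ)
    {ζ : Ω → Ξ} (hζ : Measurable ζ) (hlaw : P.map ζ = γ)
    (hind : Indep (MeasurableSpace.comap ζ inferInstance) m P) {Q : Ω → F}
    (hQ : Measurable[m] Q) : P.map (fun ω => (Q ω, ζ ω)) = (P.map Q).prod γ := by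
  have hQ' : Measurable Q := hQ.mono hm le_rfl
  have h : IndepFun Q ζ P := by
    rw [IndepFun_iff_Indep]
    exact indep_of_indep_of_le_left hind.symm hQ.comap_le
  rw [(indepFun_iff_map_prod_eq_prod_map_map hQ'.aemeasurable hζ.aemeasurable).1 h, hlaw]

variable [IsProbabilityMeasure γ]
  {E : Type*} [NormedAddCommGroup E]
  [SecondCountableTopology E] [MeasurableSpace E] [BorelSpace E] {D : E × Ξ → E} {K : NNReal}

theorem lintegral_enorm_sq_comp_le (hm : m ≤ mΩ) {ζ : Ω → Ξ}
    (hζ : Measurable ζ) (hlaw : P.map ζ = γ)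
    (hind : Indep (MeasurableSpace.comap ζ inferInstance) m P) (hD : Measurable D)
    (hK : ∀ x, ∫⁻ ξ, ‖D (x, ξ)‖ₑ ^ 2 ∂γ ≤ K) {Y : Ω → E} (hY : Measurable[m] Y) :
    ∫⁻ ω, ‖D (Y ω, ζ ω)‖ₑ ^ 2 ∂P ≤ K := by
  have hY' : Measurable Y := hY.mono hm le_rfl
  have : IsProbabilityMeasure (P.map Y) := Measure.isProbabilityMeasure_map hY'.aemeasurable
  rw [← lintegral_map (f := fun p : E × Ξ => ‖D p‖ₑ ^ 2) (by fun_prop) (hY'.prodMk hζ),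
    map_prodMk_eq_prod_of_indep hm hζ hlaw hind hY, lintegral_prod _ (by fun_prop)]
  exact (lintegral_mono hK).trans (by simp)

variable [InnerProductSpace ℝ E] [CompleteSpace E]

theorem integral_inner_comp_eq_zero (hm : m ≤ mΩ) {ζ : Ω → Ξ}
    (hζ : Measurable ζ) (hlaw : P.map ζ = γ)
    (hind : Indep (MeasurableSpace.comap ζ inferInstance) m P) (hD : Measurable D)
    (hK : ∀ x, ∫⁻ ξ, ‖D (x, ξ)‖ₑ ^ 2 ∂γ ≤ K) (h0 : ∀ x, ∫ ξ, D (x, ξ) ∂γ = 0)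
    {Y T : Ω → E} (hY : Measurable[m] Y) (hT : Measurable[m] T) (hT2 : MemLp T 2 P) :
    ∫ ω, inner ℝ (T ω) (D (Y ω, ζ ω)) ∂P = 0 := by
  have hY' : Measurable Y := hY.mono hm le_rfl
  have hT' : Measurable T := hT.mono hm le_rfl
  have hprod := map_prodMk_eq_prod_of_indep hm hζ hlaw hind (hT.prodMk hY)
  have : IsProbabilityMeasure (P.map fun ω => (T ω, Y ω)) :=
    Measure.isProbabilityMeasure_map (hT'.prodMk hY').aemeasurable
  have hf : Measurable fun p : (E × E) × Ξ => inner ℝ p.1.1 (D (p.1.2, p.2)) := by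
    have : Measurable fun p : (E × E) × Ξ => D (p.1.2, p.2) := hD.comp (by fun_prop)
    fun_prop
  have hTYζ : Measurable fun ω => ((T ω, Y ω), ζ ω) := (hT'.prodMk hY').prodMk hζ
  have hint : Integrable (fun ω => inner ℝ (T ω) (D (Y ω, ζ ω))) P :=
    integrable_inner_of_memLp_two hT2 (memLp_two_of_lintegral_enorm_sq_le
      (hD.comp (hY'.prodMk hζ)).aestronglyMeasurable
      (lintegral_enorm_sq_comp_le hm hζ hlaw hind hD hK hY))
  have hint' : Integrable (fun p : (E × E) × Ξ => inner ℝ p.1.1 (D (p.1.2, p.2)))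
      ((P.map fun ω => (T ω, Y ω)).prod γ) := by
    rw [← hprod, integrable_map_measure hf.aestronglyMeasurable hTYζ.aemeasurable]
    exact hint
  calc ∫ ω, inner ℝ (T ω) (D (Y ω, ζ ω)) ∂P
      = ∫ p, inner ℝ p.1.1 (D (p.1.2, p.2)) ∂((P.map fun ω => (T ω, Y ω)).prod γ) := by
        rw [← hprod, integral_map hTYζ.aemeasurable hf.aestronglyMeasurable]
    _ = 0 := by
        rw [integral_prod _ hint']
        refine integral_eq_zero_of_ae (.of_forall fun q => ?_)
        have hi : Integrable (fun ξ => D (q.2, ξ)) γ := (memLp_two_of_lintegral_enorm_sq_le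
          (hD.comp measurable_prodMk_left).aestronglyMeasurable (hK q.2)).integrable
          (by norm_num)
        simp only [Pi.zero_apply]
        rw [integral_inner hi, h0, inner_zero_right]

variable {ℱ : Filtration ℕ mΩ} {ξ : ℕ → Ω → Ξ} {a : ℕ → ℝ} {Y : ℕ → Ω → E}

/-- A square-summable Robbins–Monro noise series converges almost surely in the Hilbert space. -/
theorem ae_cauchySeq_sum_noise
    (hξ_meas : ∀ n, Measurable[ℱ (n + 1)] (ξ (n + 1)))
    (hξ_law : ∀ n, P.map (ξ (n + 1)) = γ)
    (hξ_indep : ∀ n, Indep (MeasurableSpace.comap (ξ (n + 1)) inferInstance) (ℱ n) P)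
    (ha_sq : Summable fun n => a n ^ 2) (hD : Measurable D)
    (hK : ∀ x, ∫⁻ ξ, ‖D (x, ξ)‖ₑ ^ 2 ∂γ ≤ K) (h0 : ∀ x, ∫ ξ, D (x, ξ) ∂γ = 0)
    (hY : ∀ n, Measurable[ℱ n] (Y n)) :
    ∀ᵐ ω ∂P, CauchySeq fun n =>
      ∑ k ∈ Finset.range n, a (k + 1) • D (Y k ω, ξ (k + 1) ω) := by
  set X : ℕ → Ω → E := fun k ω => a (k + 1) • D (Y k ω, ξ (k + 1) ω) with hX
  have hζ : ∀ n, Measurable (ξ (n + 1)) := fun n => (hξ_meas n).mono (ℱ.le _) le_rfl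
  have hXm : ∀ k, Measurable[ℱ (k + 1)] (X k) := fun k =>
    (hD.comp (((hY k).mono (ℱ.mono (Nat.le_succ k)) le_rfl).prodMk (hξ_meas k))).const_smul _
  have hX2 : ∀ k, ∫⁻ ω, ‖X k ω‖ₑ ^ 2 ∂P ≤ ((a (k + 1) ^ 2).toNNReal * K : NNReal) := by
    intro k
    have h1 : ∀ ω, ‖X k ω‖ₑ ^ 2 = ENNReal.ofReal (a (k + 1) ^ 2) *
        ‖D (Y k ω, ξ (k + 1) ω)‖ₑ ^ 2 := fun ω => by
      rw [hX, enorm_smul, mul_pow, Real.enorm_eq_ofReal_abs, ← ENNReal.ofReal_pow (abs_nonneg _),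
        sq_abs]
    simp_rw [h1]
    rw [lintegral_const_mul' _ _ ENNReal.ofReal_ne_top, ENNReal.coe_mul]
    gcongr
    · exact le_rfl
    · exact lintegral_enorm_sq_comp_le (ℱ.le k) (hζ k) (hξ_law k) (hξ_indep k) hD hK (hY k)
  have hXL : ∀ k, MemLp (X k) 2 P := fun k => memLp_two_of_lintegral_enorm_sq_le
    ((hXm k).mono (ℱ.le _) le_rfl).aestronglyMeasurable (hX2 k)
  set M : ℕ → ℕ → Ω → E := fun m n ω => ∑ k ∈ Finset.Ico m n, X k ω with hM
  have hMm : ∀ m n, Measurable[ℱ n] (M m n) := fun m n =>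
    Finset.measurable_fun_sum _ fun k hk =>
      (hXm k).mono (ℱ.mono (Finset.mem_Ico.1 hk).2) le_rfl
  have hML : ∀ m n, MemLp (M m n) 2 P := fun m n => memLp_finsetSum _ fun k _ => hXL k
  have hint : ∀ m n, Integrable (fun ω => ‖M m n ω‖ ^ 2) P := fun m n =>
    (hML m n).integrable_norm_pow (by norm_num)
  have hstep : ∀ m n, m ≤ n → ∀ ω, ‖M m (n + 1) ω‖ ^ 2 =
      ‖M m n ω‖ ^ 2 + 2 * inner ℝ (M m n ω) (X n ω) + ‖X n ω‖ ^ 2 := fun m n hmn ω => by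
    simp only [hM]
    rw [Finset.sum_Ico_succ_top hmn, norm_add_sq_real]
  have horth : ∀ m n (s : Set Ω), MeasurableSet[ℱ n] s →
      ∫ ω in s, inner ℝ (M m n ω) (X n ω) ∂P = 0 := by
    intro m n s hs
    have hs' : MeasurableSet s := ℱ.le n _ hs
    have h1 := integral_inner_comp_eq_zero (T := s.indicator (M m n)) (ℱ.le n) (hζ n)
      (hξ_law n) (hξ_indep n) hD hK h0 (hY n) ((hMm m n).indicator hs) ((hML m n).indicator hs')
    rw [← integral_indicator hs']
    calc ∫ ω, s.indicator (fun ω => inner ℝ (M m n ω) (X n ω)) ω ∂P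
        = ∫ ω, a (n + 1) * inner ℝ (s.indicator (M m n) ω) (D (Y n ω, ξ (n + 1) ω)) ∂P := by
          refine integral_congr_ae (.of_forall fun ω => ?_)
          by_cases hω : ω ∈ s <;> simp [hω, hX, inner_smul_right]
      _ = 0 := by rw [integral_const_mul, h1, mul_zero]
  have hii : ∀ m n, Integrable (fun ω => inner ℝ (M m n ω) (X n ω)) P := fun m n =>
    integrable_inner_of_memLp_two (hML m n) (hXL n)
  have hXi : ∀ n, Integrable (fun ω => ‖X n ω‖ ^ 2) P := fun n =>
    (hXL n).integrable_norm_pow (by norm_num)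
  have hset : ∀ m n, m ≤ n → ∀ s : Set Ω, MeasurableSet[ℱ n] s →
      ∫ ω in s, ‖M m (n + 1) ω‖ ^ 2 ∂P =
        ∫ ω in s, ‖M m n ω‖ ^ 2 ∂P + ∫ ω in s, ‖X n ω‖ ^ 2 ∂P := by
    intro m n hmn s hs
    simp_rw [hstep m n hmn]
    have h1 : IntegrableOn (fun ω => ‖M m n ω‖ ^ 2 + 2 * inner ℝ (M m n ω) (X n ω)) s P :=
      ((hint m n).add ((hii m n).const_mul 2)).integrableOn
    rw [integral_add h1 (hXi n).integrableOn,
      integral_add (hint m n).integrableOn ((hii m n).const_mul 2).integrableOn,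
      integral_const_mul, horth m n s hs]
    ring
  have hXn : ∀ n, ∫ ω, ‖X n ω‖ ^ 2 ∂P ≤ a (n + 1) ^ 2 * K := fun n => by
    rw [integral_eq_lintegral_of_nonneg_ae (.of_forall fun _ => by positivity)
      (hXi n).aestronglyMeasurable]
    refine ENNReal.toReal_le_of_le_ofReal (by positivity) ?_
    have h2 : ENNReal.ofReal (a (n + 1) ^ 2 * K) = ((a (n + 1) ^ 2).toNNReal * K : NNReal) := by
      rw [ENNReal.ofReal_mul (by positivity), ENNReal.ofReal_coe_nnreal, ENNReal.coe_mul]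
      rfl
    rw [h2]
    refine le_trans (lintegral_mono fun ω => ?_) (hX2 n)
    rw [ENNReal.ofReal_pow (norm_nonneg _), ofReal_norm]
  have hsum : Summable fun n => a (n + 1) ^ 2 * (K : ℝ) :=
    ((summable_nat_add_iff 1).2 ha_sq).mul_right _
  have hMle : ∀ m n, ∫ ω, ‖M m n ω‖ ^ 2 ∂P ≤ ∑' k, a (k + m + 1) ^ 2 * (K : ℝ) := by
    intro m n
    have h1 : ∫ ω, ‖M m n ω‖ ^ 2 ∂P ≤ ∑ k ∈ Finset.Ico m n, a (k + 1) ^ 2 * (K : ℝ) := by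
      induction n with
      | zero => simp [hM]
      | succ n ih =>
        rcases le_or_gt m n with hmn | hmn
        · have := hset m n hmn Set.univ MeasurableSet.univ
          simp only [setIntegral_univ] at this
          rw [this, Finset.sum_Ico_succ_top hmn]
          exact add_le_add ih (hXn n)
        · simp [hM, Finset.Ico_eq_empty_of_le (Nat.succ_le_of_lt hmn)]
    refine h1.trans ?_
    rw [Finset.sum_Ico_eq_sum_range]
    have h2 : Summable fun k => a (k + m + 1) ^ 2 * (K : ℝ) :=
      (summable_nat_add_iff (f := fun n => a (n + 1) ^ 2 * (K : ℝ)) m).2 hsum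
    simp_rw [add_comm m]
    exact h2.sum_le_tsum _ fun _ _ => by positivity
  have hMm2 : ∀ m n, Measurable[ℱ n] fun ω => ‖M m n ω‖ ^ 2 := fun m n =>
    (measurable_norm.pow_const 2).comp (hMm m n)
  have hsub : ∀ m, Submartingale (fun n ω => ‖M m n ω‖ ^ 2) ℱ P := by
    intro m
    refine submartingale_of_setIntegral_le_succ
      (fun n => (hMm2 m n).stronglyMeasurable) (hint m) fun n s hs => ?_
    rcases le_or_gt m n with hmn | hmn
    · rw [hset m n hmn s hs]
      exact le_add_of_nonneg_right (integral_nonneg fun _ => by positivity)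
    · simp [hM, Finset.Ico_eq_empty_of_le (Nat.succ_le_of_lt hmn),
        Finset.Ico_eq_empty_of_le hmn.le]
  have hMe : ∀ m n, ∫⁻ ω, ‖M m n ω‖ₑ ^ 2 ∂P ≤
      ENNReal.ofReal (∑' k, a (k + m + 1) ^ 2 * (K : ℝ)) := fun m n => by
    refine le_trans (le_of_eq ?_) (ENNReal.ofReal_le_ofReal (hMle m n))
    rw [ofReal_integral_eq_lintegral_ofReal (hint m n) (.of_forall fun _ => by positivity)]
    refine lintegral_congr fun ω => ?_
    rw [ENNReal.ofReal_pow (norm_nonneg _), ofReal_norm]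
  have hconv : ∀ m, ∀ᵐ ω ∂P, ∃ c, Tendsto (fun n => ‖M m n ω‖ ^ 2) atTop (𝓝 c) := fun m => by
    refine (hsub m).exists_ae_tendsto_of_bdd
      (R := (∑' k, a (k + m + 1) ^ 2 * (K : ℝ)).toNNReal) fun n => ?_
    rw [eLpNorm_one_eq_lintegral_enorm]
    refine le_trans (le_of_eq (lintegral_congr fun ω => ?_)) (hMe m n)
    simp
  have hmeasM : ∀ m n, Measurable fun ω => ‖M m n ω‖ₑ ^ 2 := fun m n =>
    ((hMm m n).mono (ℱ.le n) le_rfl).enorm.pow_const 2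
  have htail : Tendsto (fun m => ∑' k, a (k + m + 1) ^ 2 * (K : ℝ)) atTop (𝓝 0) :=
    tendsto_sum_nat_add fun n => a (n + 1) ^ 2 * (K : ℝ)
  have hlim0 : ∫⁻ ω, liminf (fun m => liminf (fun n => ‖M m n ω‖ₑ ^ 2) atTop) atTop ∂P = 0 := by
    refine le_antisymm ?_ zero_le
    calc _ ≤ liminf (fun m => ∫⁻ ω, liminf (fun n => ‖M m n ω‖ₑ ^ 2) atTop ∂P) atTop :=
          lintegral_liminf_le fun m => Measurable.liminf (hmeasM m)
      _ ≤ liminf (fun m => ENNReal.ofReal (∑' k, a (k + m + 1) ^ 2 * (K : ℝ))) atTop := by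
          refine liminf_le_liminf (.of_forall fun m => ?_)
          refine (lintegral_liminf_le (hmeasM m)).trans ?_
          exact (liminf_le_liminf (.of_forall (hMe m))).trans (by simp)
      _ = 0 := by
          have := (ENNReal.continuous_ofReal.tendsto 0).comp htail
          simpa [Function.comp_def] using this.liminf_eq
  rw [lintegral_eq_zero_iff (Measurable.liminf fun m => Measurable.liminf (hmeasM m))] at hlim0
  filter_upwards [hlim0, ae_all_iff.2 hconv] with ω hω hc
  rw [Metric.cauchySeq_iff']
  intro ε hε
  have hlt : liminf (fun m => liminf (fun n => ‖M m n ω‖ₑ ^ 2) atTop) atTop <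
      ENNReal.ofReal ((ε / 2) ^ 2) := by
    rw [hω]
    exact ENNReal.ofReal_pos.2 (by positivity)
  obtain ⟨m, hm⟩ := (frequently_lt_of_liminf_lt (by isBoundedDefault) hlt).exists
  obtain ⟨c, hcm⟩ := hc m
  have hcm' : Tendsto (fun n => ‖M m n ω‖ₑ ^ 2) atTop (𝓝 (ENNReal.ofReal c)) := by
    refine ((ENNReal.continuous_ofReal.tendsto c).comp hcm).congr fun n => ?_
    simp only [Function.comp]
    rw [ENNReal.ofReal_pow (norm_nonneg _), ofReal_norm]
  rw [hcm'.liminf_eq] at hm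
  have hcε : c < (ε / 2) ^ 2 := (ENNReal.ofReal_lt_ofReal_iff (by positivity)).1 hm
  obtain ⟨N, hN⟩ := eventually_atTop.1 ((hcm.eventually (gt_mem_nhds hcε)).and
    (eventually_ge_atTop m))
  have hMdiff : ∀ n ≥ N, ∑ k ∈ Finset.range n, X k ω = ∑ k ∈ Finset.range m, X k ω + M m n ω :=
    fun n hn => (Finset.sum_range_add_sum_Ico _ (hN n hn).2).symm
  refine ⟨N, fun n hn => ?_⟩
  have h1 : ∀ n ≥ N, ‖M m n ω‖ < ε / 2 := fun n hn =>
    lt_of_pow_lt_pow_left₀ 2 (by positivity) (hN n hn).1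
  change dist (∑ k ∈ Finset.range n, X k ω) (∑ k ∈ Finset.range N, X k ω) < ε
  rw [hMdiff n hn, hMdiff N le_rfl, dist_add_left, dist_eq_norm]
  linarith [norm_sub_le (M m n ω) (M m N ω), h1 n hn, h1 N le_rfl]

end MartingaleNoise

section PerturbedEuler

variable {E : Type*} [NormedAddCommGroup E] [InnerProductSpace ℝ E]

/-- One Euler step for `-h`, evaluated at a perturbed point `y`, contracts towards `x⋆`. -/
theorem norm_sub_smul_sub_sq_le {u y z xs : E} {α a δ M : ℝ} (ha : 0 ≤ a) (haδ : a ≤ δ)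
    (hα : 0 ≤ α) (hzy : ‖z - y‖ ≤ δ) (hM : ‖u‖ ≤ M)
    (hmono : α * ‖y - xs‖ ^ 2 ≤ inner ℝ u (y - xs)) :
    ‖z - a • u - xs‖ ^ 2 ≤
      (1 - α * a) * ‖z - xs‖ ^ 2 + a * (2 * α * δ ^ 2 + (2 * M + M ^ 2) * δ) := by
  have hδ : 0 ≤ δ := ha.trans haδ
  have hM0 : 0 ≤ M := (norm_nonneg u).trans hM
  have h1 : ‖z - a • u - xs‖ ^ 2 =
      ‖z - xs‖ ^ 2 - 2 * a * inner ℝ u (z - xs) + a ^ 2 * ‖u‖ ^ 2 := by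
    rw [show z - a • u - xs = (z - xs) - a • u by abel, norm_sub_sq_real, inner_smul_right,
      norm_smul, mul_pow, Real.norm_eq_abs, sq_abs, real_inner_comm]
    ring
  have h2 : inner ℝ u (z - xs) = inner ℝ u (y - xs) + inner ℝ u (z - y) := by
    rw [← inner_add_right]
    congr 1
    abel
  have h3 : -(M * δ) ≤ inner ℝ u (z - y) := by
    have := (abs_le.1 (abs_real_inner_le_norm u (z - y))).1
    have h : ‖u‖ * ‖z - y‖ ≤ M * δ := by gcongr
    linarith
  have h4 : ‖z - xs‖ ^ 2 ≤ 2 * ‖y - xs‖ ^ 2 + 2 * δ ^ 2 := by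
    have h : ‖z - xs‖ ≤ δ + ‖y - xs‖ := by
      calc ‖z - xs‖ = ‖(z - y) + (y - xs)‖ := by congr 1; abel
        _ ≤ ‖z - y‖ + ‖y - xs‖ := norm_add_le _ _
        _ ≤ δ + ‖y - xs‖ := by gcongr
    have : ‖z - xs‖ ^ 2 ≤ (δ + ‖y - xs‖) ^ 2 := by gcongr
    nlinarith [sq_nonneg (δ - ‖y - xs‖)]
  have h5 : a ^ 2 * ‖u‖ ^ 2 ≤ a * δ * M ^ 2 := by
    have : ‖u‖ ^ 2 ≤ M ^ 2 := by gcongr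
    calc a ^ 2 * ‖u‖ ^ 2 ≤ a ^ 2 * M ^ 2 := by gcongr
      _ = a * a * M ^ 2 := by ring
      _ ≤ a * δ * M ^ 2 := by gcongr
  have h6 : α * (‖z - xs‖ ^ 2 - 2 * δ ^ 2) ≤ 2 * inner ℝ u (y - xs) := by
    have := mul_le_mul_of_nonneg_left h4 hα
    linarith
  rw [h1, h2]
  have h7 := mul_le_mul_of_nonneg_left h6 ha
  have h8 := mul_le_mul_of_nonneg_left h3 (mul_nonneg (zero_le_two (α := ℝ)) ha)
  linarith

/-- On the time interval `[m, n]`, the sequence `y` is an Euler scheme for `-h` with step sizes at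
most `δ`, perturbed by noise with partial sums `w`. Both are controlled only while `y` stays within
distance `R` of `x⋆`. -/
structure IsPerturbedEuler (h : E → E) (xs : E) (a : ℕ → ℝ) (R δ : ℝ) (m n : ℕ) (y w : ℕ → E) :
    Prop where
  step_nonneg : ∀ i, m ≤ i → i < n → 0 ≤ a (i + 1)
  step_le : ∀ i, m ≤ i → i < n → a (i + 1) ≤ δ
  noise_le : ∀ i, m ≤ i → i ≤ n → ‖w i - w m‖ ≤ δ
  add_eq : ∀ i, m ≤ i → i < n → ‖y i - xs‖ ≤ R →
    y (i + 1) + w (i + 1) = y i + w i - a (i + 1) • h (y i)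

namespace IsPerturbedEuler

variable {h : E → E} {xs : E} {α δ M ρ R : ℝ} {a : ℕ → ℝ} {m n : ℕ} {y w : ℕ → E}

theorem shifted_eq (H : IsPerturbedEuler h xs a R δ m n y w) {i : ℕ} (hmi : m ≤ i) (hin : i < n)
    (hyR : ‖y i - xs‖ ≤ R) :
    y (i + 1) + (w (i + 1) - w m) = y i + (w i - w m) - a (i + 1) • h (y i) := by
  rw [← add_sub_assoc, H.add_eq i hmi hin hyR]
  abel

/-- A perturbed Euler scheme for a strongly monotone field approaches the zero of the field at an
exponential rate, up to an error that is controlled by the size `δ` of steps and noise. -/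
theorem norm_shifted_sub_sq_le (H : IsPerturbedEuler h xs a R δ m n y w)
    (hα : 0 < α) (hδ : 0 ≤ δ) (hαδ : α * δ ≤ 1) (hM0 : 0 ≤ M)
    (hM : ∀ x, ‖x - xs‖ ≤ R → ‖h x‖ ≤ M)
    (hmono : ∀ i, m ≤ i → i < n → α * ‖y i - xs‖ ^ 2 ≤ inner ℝ (h (y i)) (y i - xs))
    (hρ : ‖y m - xs‖ ≤ ρ)
    (hR : ∀ i, m ≤ i → i ≤ n → ‖y i + (w i - w m) - xs‖ ^ 2 ≤
      ρ ^ 2 * Real.exp (-(α * ∑ k ∈ Finset.Ico m i, a (k + 1))) +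
        (2 * α * δ ^ 2 + (2 * M + M ^ 2) * δ) / α → ‖y i - xs‖ ≤ R)
    {i : ℕ} (hmi : m ≤ i) (hin : i ≤ n) :
    ‖y i + (w i - w m) - xs‖ ^ 2 ≤
      ρ ^ 2 * Real.exp (-(α * ∑ k ∈ Finset.Ico m i, a (k + 1))) +
        (2 * α * δ ^ 2 + (2 * M + M ^ 2) * δ) / α := by
  set κ := 2 * α * δ ^ 2 + (2 * M + M ^ 2) * δ with hκ
  induction i, hmi using Nat.le_induction with
  | base =>
    have h0 : ‖y m - xs‖ ^ 2 ≤ ρ ^ 2 := by gcongr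
    have : 0 ≤ κ / α := by positivity
    simpa using h0.trans (le_add_of_nonneg_right this)
  | succ i hmi ih =>
    have hin' : i < n := hin
    have hsq := ih hin'.le
    have hyR := hR i hmi hin'.le hsq
    have ha0 := H.step_nonneg i hmi hin'
    have haδ := H.step_le i hmi hin'
    rw [H.shifted_eq hmi hin' hyR]
    have h1 := norm_sub_smul_sub_sq_le (z := y i + (w i - w m)) ha0 haδ hα.le
      (by simpa using H.noise_le i hmi hin'.le) (hM _ hyR) (hmono i hmi hin')
    refine h1.trans ?_
    rw [← hκ, Finset.sum_Ico_succ_top hmi, mul_add α, neg_add, Real.exp_add, ← mul_assoc]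
    have h2 : 0 ≤ 1 - α * a (i + 1) := by
      have := mul_le_mul_of_nonneg_left haδ hα.le
      linarith
    have h3 : 1 - α * a (i + 1) ≤ Real.exp (-(α * a (i + 1))) := by
      have := Real.add_one_le_exp (-(α * a (i + 1)))
      linarith
    set X := ρ ^ 2 * Real.exp (-(α * ∑ k ∈ Finset.Ico m i, a (k + 1))) with hX
    have hX0 : 0 ≤ X := by positivity
    have h4 : (1 - α * a (i + 1)) * ‖y i + (w i - w m) - xs‖ ^ 2 ≤
        (1 - α * a (i + 1)) * (X + κ / α) := by gcongr
    have h5 : X * (1 - α * a (i + 1)) ≤ X * Real.exp (-(α * a (i + 1))) := by gcongr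
    have h6 : α * a (i + 1) * (κ / α) = a (i + 1) * κ := by field_simp
    linarith

theorem norm_sub_le_of_shifted (H : IsPerturbedEuler h xs a R δ m n y w) {i : ℕ} (hmi : m ≤ i)
    (hin : i ≤ n) {q : E} {b : ℝ} (hb : 0 ≤ b)
    (hc : ‖y i + (w i - w m) - q‖ ^ 2 ≤ b ^ 2) :
    ‖y i - q‖ ≤ b + δ := by
  have h1 : ‖y i + (w i - w m) - q‖ ≤ b := by nlinarith [norm_nonneg (y i + (w i - w m) - q)]
  calc ‖y i - q‖ = ‖(y i + (w i - w m) - q) - (w i - w m)‖ := by congr 1; abel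
    _ ≤ ‖y i + (w i - w m) - q‖ + ‖w i - w m‖ := norm_sub_le _ _
    _ ≤ b + δ := add_le_add h1 (H.noise_le i hmi hin)

/-- A perturbed Euler scheme with small steps and little noise stays near the ball in which it
starts. -/
theorem eventually_norm_sub_le (hα : 0 < α) (hM0 : 0 ≤ M)
    (hM : ∀ x, ‖x - xs‖ ≤ R → ‖h x‖ ≤ M) (hρ0 : 0 ≤ ρ) {ρ' : ℝ} (hρρ' : ρ < ρ') (hρR : ρ' ≤ R)
    {c : ℝ} (hc : 0 < c) :
    ∀ᶠ δ in 𝓝[>] (0 : ℝ), 0 < δ ∧ δ ≤ c ∧ ∀ (a : ℕ → ℝ) (m n : ℕ) (y w : ℕ → E),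
      IsPerturbedEuler h xs a R δ m n y w →
      (∀ i, m ≤ i → i < n → α * ‖y i - xs‖ ^ 2 ≤ inner ℝ (h (y i)) (y i - xs)) →
      ‖y m - xs‖ ≤ ρ → ∀ i, m ≤ i → i ≤ n → ‖y i - xs‖ < ρ' ∧
        ‖y i + (w i - w m) - xs‖ ^ 2 ≤
          ρ ^ 2 * Real.exp (-(α * ∑ k ∈ Finset.Ico m i, a (k + 1))) + c := by
  set e := (ρ' - ρ) / 3 with he
  have he0 : 0 < e := by rw [he]; linarith
  have hκ : Tendsto (fun δ : ℝ => (2 * α * δ ^ 2 + (2 * M + M ^ 2) * δ) / α) (𝓝[>] 0) (𝓝 0) := by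
    refine Tendsto.mono_left ?_ nhdsWithin_le_nhds
    have : Continuous fun δ : ℝ => (2 * α * δ ^ 2 + (2 * M + M ^ 2) * δ) / α := by fun_prop
    simpa using this.tendsto 0
  have hid : Tendsto (fun δ : ℝ => δ) (𝓝[>] 0) (𝓝 0) := nhdsWithin_le_nhds
  have hcc : 0 < min c (min e (e ^ 2)) := by positivity
  filter_upwards [hκ.eventually (gt_mem_nhds hcc), hid.eventually (gt_mem_nhds hcc),
    hid.eventually (gt_mem_nhds (one_div_pos.2 hα)), self_mem_nhdsWithin] with δ h1 h2 h3 hδ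
  rw [lt_min_iff, lt_min_iff] at h1 h2
  have hδ0 : 0 < δ := hδ
  refine ⟨hδ0, h2.1.le, fun a m n y w H hmono hρ => ?_⟩
  have hαδ : α * δ ≤ 1 := by
    rw [lt_div_iff₀ hα] at h3
    linarith
  have ha0 : ∀ i, i ≤ n → 0 ≤ ∑ k ∈ Finset.Ico m i, a (k + 1) := fun i hi =>
    Finset.sum_nonneg fun k hk => H.step_nonneg k (Finset.mem_Ico.1 hk).1
      ((Finset.mem_Ico.1 hk).2.trans_le hi)
  have hR : ∀ i, m ≤ i → i ≤ n → ‖y i + (w i - w m) - xs‖ ^ 2 ≤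
      ρ ^ 2 * Real.exp (-(α * ∑ k ∈ Finset.Ico m i, a (k + 1))) +
        (2 * α * δ ^ 2 + (2 * M + M ^ 2) * δ) / α → ‖y i - xs‖ < ρ' := by
    intro i hmi hin hi
    have hexp : Real.exp (-(α * ∑ k ∈ Finset.Ico m i, a (k + 1))) ≤ 1 := by
      rw [Real.exp_le_one_iff, neg_nonpos]
      exact mul_nonneg hα.le (ha0 i hin)
    have hle : ρ ^ 2 * Real.exp (-(α * ∑ k ∈ Finset.Ico m i, a (k + 1))) ≤ ρ ^ 2 :=
      mul_le_of_le_one_right (by positivity) hexp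
    have hb : ‖y i + (w i - w m) - xs‖ ^ 2 ≤ (ρ + e) ^ 2 := by nlinarith [h1.2.2]
    have := H.norm_sub_le_of_shifted hmi hin (by positivity) hb
    have he3 : 3 * e = ρ' - ρ := by rw [he]; ring
    linarith [h2.2.1]
  intro i hmi hin
  have hsq := H.norm_shifted_sub_sq_le hα hδ0.le hαδ hM0 hM hmono hρ
    (fun i hmi hin hi => ((hR i hmi hin hi).trans_le hρR).le) hmi hin
  exact ⟨hR i hmi hin hsq, hsq.trans (by linarith [h1.1])⟩

end IsPerturbedEuler

end PerturbedEuler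

section CoarseEuler

theorem eventually_tail_small {E : Type*} [NormedAddCommGroup E] {a : ℕ → ℝ} {w : ℕ → E} {δ : ℝ}
    (ha : Tendsto a atTop (𝓝 0)) (hw : CauchySeq w) (hδ : 0 < δ) :
    ∀ᶠ m in atTop, ∀ i, m ≤ i → a (i + 1) ≤ δ ∧ ‖w i - w m‖ ≤ δ := by
  obtain ⟨N, hN⟩ := Metric.cauchySeq_iff.1 hw δ hδ
  obtain ⟨N', hN'⟩ := eventually_atTop.1 (ha.eventually (gt_mem_nhds hδ))
  filter_upwards [eventually_ge_atTop N, eventually_ge_atTop N'] with m hm hm' i hi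
  refine ⟨(hN' _ (by omega)).le, ?_⟩
  rw [← dist_eq_norm]
  exact (hN i (hm.trans hi) m hm).le

variable {E : Type*} [NormedAddCommGroup E] [InnerProductSpace ℝ E]

/-- The points that are reached from `K` by `l` Euler steps for `-h` of size at most `2 η`. -/
def eulerImages (h : E → E) (K : Set E) (η : ℝ) : ℕ → Set E
  | 0 => K
  | l + 1 => (fun p : E × ℝ => p.1 - p.2 • h p.1) '' (eulerImages h K η l ×ˢ Set.Icc 0 (2 * η))

variable {h : E → E} {K : Set E} {xs : E} {α δ η M ρ R : ℝ} {a : ℕ → ℝ} {m n : ℕ} {y w : ℕ → E}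

theorem sub_smul_mem_eulerImages {l : ℕ} {Y : E} (hY : Y ∈ eulerImages h K η l) {s : ℝ}
    (hs0 : 0 ≤ s) (hs : s ≤ 2 * η) : Y - s • h Y ∈ eulerImages h K η (l + 1) :=
  ⟨(Y, s), ⟨hY, hs0, hs⟩, rfl⟩

theorem isCompact_eulerImages (hh : Continuous h) (hK : IsCompact K) (l : ℕ) :
    IsCompact (eulerImages h K η l) := by
  induction l with
  | zero => exact hK
  | succ l ih => exact (ih.prod isCompact_Icc).image (by fun_prop)

theorem monotone_eulerImages (hη : 0 ≤ η) : Monotone (eulerImages h K η) := by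
  refine monotone_nat_of_le_succ fun l Y hY => ?_
  simpa using sub_smul_mem_eulerImages hY le_rfl (by linarith : (0 : ℝ) ≤ 2 * η)

namespace IsPerturbedEuler

/-- A perturbed Euler scheme with small steps is tracked by an unperturbed one with larger steps,
of sizes between `η` and `2 η`. -/
theorem exists_mem_eulerImages_near (H : IsPerturbedEuler h xs a R δ m n y w)
    (hα : 0 ≤ α) (hM : ∀ x, ‖x - xs‖ ≤ R → ‖h x‖ ≤ M)
    (hmono : ∀ x y, α * ‖x - y‖ ^ 2 ≤ inner ℝ (h x - h y) (x - y)) (hxs : h xs = 0)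
    (hη0 : 0 ≤ η) (hδη : δ ≤ η) (hηα : 4 * η * α ≤ 1) (hηM : η * M ^ 2 ≤ α * ρ ^ 2)
    (hρR : ρ ≤ R) (hyK : y m ∈ K) (hρ : ‖y m - xs‖ ≤ ρ) (hyR : ∀ i, m ≤ i → i ≤ n → ‖y i - xs‖ ≤ R)
    {i : ℕ} (hmi : m ≤ i) (hin : i ≤ n) :
    ∃ (Y : E) (s : ℝ) (l : ℕ), Y ∈ eulerImages h K η l ∧ ‖Y - xs‖ ≤ ρ ∧ 0 ≤ s ∧ s ≤ η ∧
      l * η + s ≤ ∑ k ∈ Finset.Ico m i, a (k + 1) ∧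
      ‖y i + (w i - w m) - (Y - s • h Y)‖ ^ 2 ≤
        (∑ k ∈ Finset.Ico m i, a (k + 1)) * (4 * M * (δ + η * M) + 4 * M ^ 2 * δ) := by
  have hρ0 : 0 ≤ ρ := (norm_nonneg _).trans hρ
  induction i, hmi using Nat.le_induction with
  | base => exact ⟨y m, 0, 0, hyK, hρ, le_rfl, hη0, by simp, by simp⟩
  | succ i hmi ih =>
    have hin' : i < n := hin
    obtain ⟨Y, s, l, hY, hYρ, hs0, hsη, hl, hdist⟩ := ih hin'.le
    have ha0 := H.step_nonneg i hmi hin'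
    have haδ := H.step_le i hmi hin'
    have hyi := hyR i hmi hin'.le
    have hMy := hM _ hyi
    have hMY := hM Y (hYρ.trans hρR)
    set b := a (i + 1) with hb
    set z := y i + (w i - w m) with hz
    have hdist' : ‖y (i + 1) + (w (i + 1) - w m) - (Y - (s + b) • h Y)‖ ^ 2 ≤
        (∑ k ∈ Finset.Ico m (i + 1), a (k + 1)) * (4 * M * (δ + η * M) + 4 * M ^ 2 * δ) := by
      rw [H.shifted_eq hmi hin' hyi, Finset.sum_Ico_succ_top hmi]
      have h1 : y i + (w i - w m) - b • h (y i) - (Y - (s + b) • h Y) =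
          (z - (Y - s • h Y)) - b • (h (y i) - h Y) := by
        rw [hz, add_smul, smul_sub]
        abel
      rw [h1, norm_sub_sq_real, inner_smul_right, norm_smul, mul_pow, Real.norm_eq_abs, sq_abs]
      have h2 : ‖h (y i) - h Y‖ ≤ 2 * M := by linarith [norm_sub_le (h (y i)) (h Y)]
      have h3 : -(2 * M * (δ + η * M)) ≤ inner ℝ (z - (Y - s • h Y)) (h (y i) - h Y) := by
        have h4 : z - (Y - s • h Y) = (y i - Y) + ((w i - w m) + s • h Y) := by
          rw [hz]
          abel
        rw [h4, inner_add_left]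
        have h5 : 0 ≤ inner ℝ (y i - Y) (h (y i) - h Y) := by
          rw [real_inner_comm]
          exact le_trans (by positivity) (hmono (y i) Y)
        have h6 : ‖(w i - w m) + s • h Y‖ ≤ δ + η * M := by
          refine (norm_add_le _ _).trans (add_le_add (H.noise_le i hmi hin'.le) ?_)
          rw [norm_smul, Real.norm_eq_abs, abs_of_nonneg hs0]
          gcongr
        have h7 := (abs_le.1 (abs_real_inner_le_norm ((w i - w m) + s • h Y)
          (h (y i) - h Y))).1
        have h8 : ‖(w i - w m) + s • h Y‖ * ‖h (y i) - h Y‖ ≤ (δ + η * M) * (2 * M) :=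
          mul_le_mul h6 h2 (norm_nonneg _) ((norm_nonneg _).trans h6)
        linarith
      have h9 : b ^ 2 * ‖h (y i) - h Y‖ ^ 2 ≤ b * (4 * M ^ 2 * δ) := by
        calc b ^ 2 * ‖h (y i) - h Y‖ ^ 2 ≤ b ^ 2 * (2 * M) ^ 2 := by gcongr
          _ = b * (4 * M ^ 2 * b) := by ring
          _ ≤ b * (4 * M ^ 2 * δ) := by gcongr
      have h10 := mul_le_mul_of_nonneg_left h3 ha0
      linarith
    have hl' : l * η + (s + b) ≤ ∑ k ∈ Finset.Ico m (i + 1), a (k + 1) := by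
      rw [Finset.sum_Ico_succ_top hmi]
      linarith
    rcases le_or_gt (s + b) η with hsb | hsb
    · exact ⟨Y, s + b, l, hY, hYρ, by positivity, hsb, hl', hdist'⟩
    · have hsb2 : s + b ≤ 2 * η := by linarith
      have hsb0 : 0 ≤ s + b := by positivity
      refine ⟨Y - (s + b) • h Y, 0, l + 1, sub_smul_mem_eulerImages hY hsb0 hsb2, ?_, le_rfl, hη0,
        ?_, by simpa using hdist'⟩
      · have h1 : ‖Y - (s + b) • h Y - xs‖ ^ 2 =
            ‖Y - xs‖ ^ 2 - 2 * (s + b) * inner ℝ (h Y) (Y - xs) + (s + b) ^ 2 * ‖h Y‖ ^ 2 := by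
          rw [show Y - (s + b) • h Y - xs = (Y - xs) - (s + b) • h Y by abel, norm_sub_sq_real,
            inner_smul_right, norm_smul, mul_pow, Real.norm_eq_abs, sq_abs, real_inner_comm]
          ring
        have h2 : α * ‖Y - xs‖ ^ 2 ≤ inner ℝ (h Y) (Y - xs) := by
          simpa [hxs] using hmono Y xs
        have h3 : (s + b) ^ 2 * ‖h Y‖ ^ 2 ≤ 2 * (s + b) * (α * ρ ^ 2) := by
          calc (s + b) ^ 2 * ‖h Y‖ ^ 2 ≤ (s + b) ^ 2 * M ^ 2 := by gcongr
            _ = (s + b) * ((s + b) * M ^ 2) := by ring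
            _ ≤ (s + b) * (2 * η * M ^ 2) := by gcongr
            _ = 2 * (s + b) * (η * M ^ 2) := by ring
            _ ≤ 2 * (s + b) * (α * ρ ^ 2) := by gcongr
        have h4 := mul_le_mul_of_nonneg_left h2 hsb0
        have h5 : ‖Y - xs‖ ^ 2 ≤ ρ ^ 2 := by gcongr
        have h6 : 0 ≤ 1 - 2 * (s + b) * α := by
          have := mul_le_mul_of_nonneg_right hsb2 hα
          linarith
        have h7 : 0 ≤ (1 - 2 * (s + b) * α) * (ρ ^ 2 - ‖Y - xs‖ ^ 2) :=
          mul_nonneg h6 (by linarith)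
        refine (sq_le_sq₀ (norm_nonneg _) hρ0).1 ?_
        rw [h1]
        linarith
      · push_cast
        linarith

/-- Perturbed Euler schemes that start in a compact set stay near a compact set. -/
theorem exists_isCompact_eventually_near (hα : 0 < α) (hh : Continuous h)
    (hbdd : ∀ R : ℝ, ∃ M, ∀ x, ‖x - xs‖ ≤ R → ‖h x‖ ≤ M)
    (hmono : ∀ x y, α * ‖x - y‖ ^ 2 ≤ inner ℝ (h x - h y) (x - y)) (hxs : h xs = 0)
    (hK : IsCompact K) (hρ0 : 0 < ρ) (hKρ : ∀ x ∈ K, ‖x - xs‖ ≤ ρ) (hρR : ρ < R)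
    {ε : ℝ} (hε : 0 < ε) :
    ∃ C : Set E, IsCompact C ∧ ∀ᶠ δ in 𝓝[>] (0 : ℝ),
      ∀ (a : ℕ → ℝ) (m n : ℕ) (y w : ℕ → E), IsPerturbedEuler h xs a R δ m n y w → y m ∈ K →
        ∀ i, m ≤ i → i ≤ n → ∃ c ∈ C, ‖y i - c‖ ≤ ε := by
  obtain ⟨M, hM⟩ := hbdd R
  have hM0 : 0 ≤ M := by simpa [hxs] using hM xs (by simpa using (hρ0.trans hρR).le)
  obtain ⟨T, hT0, hT⟩ : ∃ T : ℝ, 0 ≤ T ∧ ρ ^ 2 * Real.exp (-(α * T)) < ε ^ 2 / 8 := by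
    have h1 : Tendsto (fun T : ℝ => ρ ^ 2 * Real.exp (-(α * T))) atTop (𝓝 (ρ ^ 2 * 0)) :=
      (Real.tendsto_exp_neg_atTop_nhds_zero.comp
        (tendsto_id.const_mul_atTop hα)).const_mul _
    rw [mul_zero] at h1
    obtain ⟨T, h2, h3⟩ := ((eventually_ge_atTop (0 : ℝ)).and
      (h1.eventually (gt_mem_nhds (by positivity : 0 < ε ^ 2 / 8)))).exists
    exact ⟨T, h2, h3⟩
  have hlin : ∀ c b : ℝ, 0 < b → ∀ᶠ η in 𝓝[>] (0 : ℝ), c * η < b := fun c b hb => by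
    have h1 : Tendsto (fun η : ℝ => c * η) (𝓝[>] 0) (𝓝 0) := by
      refine Tendsto.mono_left ?_ nhdsWithin_le_nhds
      simpa using (continuous_const_mul c).tendsto 0
    exact h1.eventually (gt_mem_nhds hb)
  obtain ⟨η, ⟨⟨hη1, hη2⟩, hη3⟩, hη⟩ := ((((hlin (4 * α) 1 one_pos).and
    (hlin (M ^ 2) (α * ρ ^ 2) (by positivity))).and
    (hlin (T * (4 * M * M)) (ε ^ 2 / 8) (by positivity))).and self_mem_nhdsWithin).exists
  have hη0 : 0 < η := hη
  refine ⟨insert xs (eulerImages h K η (⌈T / η⌉₊ + 1)),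
    (isCompact_eulerImages hh hK _).insert _, ?_⟩
  filter_upwards [eventually_norm_sub_le hα hM0 hM hρ0.le hρR le_rfl
    (by positivity : 0 < ε ^ 2 / 8), hlin 1 η hη0,
    hlin (T * (4 * M + 4 * M ^ 2)) (ε ^ 2 / 8) (by positivity),
    hlin 1 (ε / 2) (by positivity)] with δ h1 h2 h3 h4 a m n y w H hyK i hmi hin
  obtain ⟨hδ0, -, hδ⟩ := h1
  have hmono' : ∀ i, m ≤ i → i < n → α * ‖y i - xs‖ ^ 2 ≤ inner ℝ (h (y i)) (y i - xs) :=
    fun i _ _ => by simpa [hxs] using hmono (y i) xs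
  have hb := hδ a m n y w H hmono' (hKρ _ hyK)
  rcases le_or_gt (∑ k ∈ Finset.Ico m i, a (k + 1)) T with hsum | hsum
  · obtain ⟨Y, s, l, hY, -, hs0, hsη, hl, hdist⟩ := H.exists_mem_eulerImages_near hα.le hM hmono
      hxs hη0.le (by linarith) (by linarith) (by linarith) hρR.le hyK (hKρ _ hyK)
      (fun i hmi hin => (hb i hmi hin).1.le) hmi hin
    have hlL : l ≤ ⌈T / η⌉₊ := by
      have : (l : ℝ) ≤ T / η := by
        rw [le_div_iff₀ hη0]
        linarith
      exact_mod_cast this.trans (Nat.le_ceil _)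
    refine ⟨Y - s • h Y, Set.mem_insert_of_mem _ (monotone_eulerImages hη0.le
      (Nat.succ_le_succ hlL) (sub_smul_mem_eulerImages hY hs0 (by linarith))), ?_⟩
    have h5 : ‖y i + (w i - w m) - (Y - s • h Y)‖ ^ 2 ≤ (ε / 2) ^ 2 := by
      refine hdist.trans ?_
      have h6 : 0 ≤ 4 * M * (δ + η * M) + 4 * M ^ 2 * δ := by positivity
      have := mul_le_mul_of_nonneg_right hsum h6
      nlinarith
    have := H.norm_sub_le_of_shifted hmi hin (by positivity) h5
    linarith
  · refine ⟨xs, Set.mem_insert _ _, ?_⟩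
    have h5 : ‖y i + (w i - w m) - xs‖ ^ 2 ≤ (ε / 2) ^ 2 := by
      refine (hb i hmi hin).2.trans ?_
      have h6 : ρ ^ 2 * Real.exp (-(α * ∑ k ∈ Finset.Ico m i, a (k + 1))) ≤
          ρ ^ 2 * Real.exp (-(α * T)) := by gcongr
      nlinarith
    have := H.norm_sub_le_of_shifted hmi hin (by positivity) h5
    linarith

end IsPerturbedEuler

/-- A bounded Robbins–Monro sequence with convergent noise converges. -/
theorem tendsto_of_eventually_euler (hα : 0 < α) (ha0 : ∀ n, 0 < a n)
    (ha : Tendsto a atTop (𝓝 0)) (ha_sum : ¬ Summable a) (hw : CauchySeq w)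
    (hbdd : ∀ R : ℝ, ∃ M, ∀ x, ‖x - xs‖ ≤ R → ‖h x‖ ≤ M) {N : ℕ}
    (hmono : ∀ n, N ≤ n → α * ‖y n - xs‖ ^ 2 ≤ inner ℝ (h (y n)) (y n - xs))
    (hyR : ∀ n, N ≤ n → ‖y n - xs‖ ≤ R)
    (hy : ∀ n, N ≤ n → y (n + 1) + w (n + 1) = y n + w n - a (n + 1) • h (y n)) :
    Tendsto y atTop (𝓝 xs) := by
  have hR0 : 0 ≤ R := (norm_nonneg _).trans (hyR N le_rfl)
  obtain ⟨M, hM⟩ := hbdd (R + 1)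
  have hM0 : 0 ≤ M := (norm_nonneg _).trans (hM xs (by simpa using by linarith))
  rw [Metric.tendsto_atTop']
  intro ε hε
  have hc : 0 < min (ε ^ 2 / 32) (ε / 4) := by positivity
  obtain ⟨δ, hδ0, hδc, hδ⟩ := (IsPerturbedEuler.eventually_norm_sub_le (ρ' := R + 1) hα hM0 hM hR0
    (lt_add_one R) le_rfl hc).exists
  obtain ⟨m, hm, hmN⟩ := ((eventually_tail_small ha hw hδ0).and (eventually_ge_atTop N)).exists
  have hdiv : Tendsto (fun n => ∑ k ∈ Finset.Ico m n, a (k + 1)) atTop atTop := by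
    have h1 : Tendsto (fun n => ∑ k ∈ Finset.range n, a (k + 1)) atTop atTop :=
      (not_summable_iff_tendsto_nat_atTop_of_nonneg fun n => (ha0 _).le).1
        (fun h => ha_sum ((summable_nat_add_iff 1).1 h))
    refine (tendsto_atTop_add_const_right _ (-∑ k ∈ Finset.range m, a (k + 1)) h1).congr' ?_
    filter_upwards [eventually_ge_atTop m] with n hn
    rw [Finset.sum_Ico_eq_sub _ hn, sub_eq_add_neg]
  have hexp : Tendsto (fun n => R ^ 2 * Real.exp (-(α * ∑ k ∈ Finset.Ico m n, a (k + 1)))) atTop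
      (𝓝 (R ^ 2 * 0)) :=
    (Real.tendsto_exp_neg_atTop_nhds_zero.comp (hdiv.const_mul_atTop hα)).const_mul _
  rw [mul_zero] at hexp
  obtain ⟨N', hN'⟩ := eventually_atTop.1
    (hexp.eventually (gt_mem_nhds (by positivity : 0 < ε ^ 2 / 32)))
  refine ⟨max m N', fun n hn => ?_⟩
  have hmn : m ≤ n := (le_max_left _ _).trans hn.le
  have H : IsPerturbedEuler h xs a (R + 1) δ m n y w :=
    { step_nonneg := fun i _ _ => (ha0 _).le
      step_le := fun i hi _ => (hm i hi).1
      noise_le := fun i hi _ => (hm i hi).2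
      add_eq := fun i hi _ _ => hy i (hmN.trans hi) }
  have h1 := (hδ a m n y w H (fun i hi _ => hmono i (hmN.trans hi)) (hyR m hmN) n hmn le_rfl).2
  have h2 := hN' n ((le_max_right _ _).trans hn.le)
  have h3 : ‖y n + (w n - w m) - xs‖ ^ 2 ≤ (ε / 4) ^ 2 := by
    have := min_le_left (ε ^ 2 / 32) (ε / 4)
    nlinarith
  have h4 := H.norm_sub_le_of_shifted hmn le_rfl (by positivity) h3
  rw [dist_eq_norm]
  linarith [min_le_right (ε ^ 2 / 32) (ε / 4)]

end CoarseEuler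

section TruncatedRobbinsMonro

variable {E Ξ : Type*} [NormedAddCommGroup E] [InnerProductSpace ℝ E] {F : E → Ξ → E}
  {a : ℕ → ℝ} {U : ℕ → Set E} {x₀ : E} {r : ℕ → ℕ → E} {ξ : ℕ → Ξ}

/-- The proposal that is made after `n` steps. -/
noncomputable def rmProposal (F : E → Ξ → E) (a : ℕ → ℝ) (U : ℕ → Set E) (x₀ : E)
    (r : ℕ → ℕ → E) (ξ : ℕ → Ξ)
    (n : ℕ) : E :=
  (truncatedRM F a U x₀ r ξ n).1 - a (n + 1) • F (truncatedRM F a U x₀ r ξ n).1 (ξ (n + 1))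

theorem truncatedRM_succ_of_mem {n : ℕ}
    (hp : rmProposal F a U x₀ r ξ n ∈ U (truncatedRM F a U x₀ r ξ n).2) :
    truncatedRM F a U x₀ r ξ (n + 1) =
      (rmProposal F a U x₀ r ξ n, (truncatedRM F a U x₀ r ξ n).2) :=
  if_pos hp

theorem truncatedRM_succ_of_notMem {n : ℕ}
    (hp : rmProposal F a U x₀ r ξ n ∉ U (truncatedRM F a U x₀ r ξ n).2) :
    truncatedRM F a U x₀ r ξ (n + 1) =
      (r (truncatedRM F a U x₀ r ξ n).2 (n + 1), (truncatedRM F a U x₀ r ξ n).2 + 1) :=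
  if_neg hp

theorem truncatedRM_snd_succ (n : ℕ) :
    (truncatedRM F a U x₀ r ξ (n + 1)).2 = (truncatedRM F a U x₀ r ξ n).2 ∨
      (truncatedRM F a U x₀ r ξ (n + 1)).2 = (truncatedRM F a U x₀ r ξ n).2 + 1 := by
  by_cases hp : rmProposal F a U x₀ r ξ n ∈ U (truncatedRM F a U x₀ r ξ n).2
  · exact .inl (by rw [truncatedRM_succ_of_mem hp])
  · exact .inr (by rw [truncatedRM_succ_of_notMem hp])

theorem truncatedRM_snd_eq_iff (n : ℕ) :
    (truncatedRM F a U x₀ r ξ (n + 1)).2 = (truncatedRM F a U x₀ r ξ n).2 ↔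
      rmProposal F a U x₀ r ξ n ∈ U (truncatedRM F a U x₀ r ξ n).2 := by
  by_cases hp : rmProposal F a U x₀ r ξ n ∈ U (truncatedRM F a U x₀ r ξ n).2
  · simp [truncatedRM_succ_of_mem hp, hp]
  · simp [truncatedRM_succ_of_notMem hp, hp]

theorem monotone_truncatedRM_snd : Monotone fun n => (truncatedRM F a U x₀ r ξ n).2 :=
  monotone_nat_of_le_succ fun n => by
    rcases truncatedRM_snd_succ (F := F) (a := a) (U := U) (x₀ := x₀) (r := r) (ξ := ξ) n with h | h
      <;> omega

theorem truncatedRM_snd_le (n : ℕ) : (truncatedRM F a U x₀ r ξ n).2 ≤ n := by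
  induction n with
  | zero => exact le_rfl
  | succ n ih =>
    rcases truncatedRM_snd_succ (F := F) (a := a) (U := U) (x₀ := x₀) (r := r) (ξ := ξ) n with h | h
      <;> omega

theorem exists_truncatedRM_snd_eventually_const
    (hb : ¬ ∀ K, ∃ n, K ≤ (truncatedRM F a U x₀ r ξ n).2) :
    ∃ N, ∀ n, N ≤ n → (truncatedRM F a U x₀ r ξ n).2 = (truncatedRM F a U x₀ r ξ N).2 := by
  push Not at hb
  obtain ⟨K, hK⟩ := hb
  have hfin : (Set.range fun n => (truncatedRM F a U x₀ r ξ n).2).Finite :=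
    (Set.finite_lt_nat K).subset (Set.range_subset_iff.2 hK)
  obtain ⟨_, ⟨N, rfl⟩, hN⟩ := hfin.exists_maximal (Set.range_nonempty _)
  exact ⟨N, fun n hn => le_antisymm (hN ⟨n, rfl⟩ (monotone_truncatedRM_snd hn))
    (monotone_truncatedRM_snd hn)⟩

/-- Between two truncations, the iteration is an untruncated Robbins–Monro scheme that starts at a
restart point and ends with a proposal outside the trust region. -/
theorem exists_segment (hub : ∀ K, ∃ n, K ≤ (truncatedRM F a U x₀ r ξ n).2) {K : ℕ} (hK : 1 ≤ K) :
    ∃ (m n : ℕ) (y : ℕ → E), K ≤ m ∧ m < n ∧ y m = r (K - 1) m ∧ y n ∉ U K ∧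
      (∀ i, m ≤ i → i < n → y i = (truncatedRM F a U x₀ r ξ i).1) ∧
      (∀ i, m < i → i < n → y i ∈ U K) ∧
      ∀ i, m ≤ i → i < n → y (i + 1) = y i - a (i + 1) • F (y i) (ξ (i + 1)) := by
  classical
  set s := truncatedRM F a U x₀ r ξ with hs
  -- the step that raises the number of truncations to `L`
  have hfirst : ∀ L, 1 ≤ L → ∃ j, (s j).2 + 1 = L ∧ (s (j + 1)).2 = L ∧
      rmProposal F a U x₀ r ξ j ∉ U (s j).2 := fun L hL => by
    have h0 : Nat.find (hub L) ≠ 0 := fun h => by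
      have := Nat.find_spec (hub L)
      rw [h] at this
      change L ≤ 0 at this
      omega
    obtain ⟨j, hj⟩ := Nat.exists_eq_succ_of_ne_zero h0
    have h1 : L ≤ (s (j + 1)).2 := by
      have := Nat.find_spec (hub L)
      rwa [hj] at this
    have h2 : (s j).2 < L := not_le.1 (Nat.find_min (hub L) (by omega))
    have h3 := truncatedRM_snd_succ (F := F) (a := a) (U := U) (x₀ := x₀) (r := r) (ξ := ξ) j
    rw [← hs] at h3
    refine ⟨j, by omega, by omega, fun hp => ?_⟩
    have : (s (j + 1)).2 = (s j).2 := (truncatedRM_snd_eq_iff j).2 hp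
    omega
  obtain ⟨j, hj1, hj2, hj3⟩ := hfirst K hK
  obtain ⟨t, ht1, ht2, ht3⟩ := hfirst (K + 1) (by omega)
  have hmono : Monotone fun n => (s n).2 := monotone_truncatedRM_snd
  have hjt : j + 1 ≤ t := by
    by_contra hlt
    have := hmono (show t + 1 ≤ j + 1 by omega)
    simp only at this
    omega
  have hσ : ∀ i, j + 1 ≤ i → i ≤ t → (s i).2 = K := fun i hi hit => by
    have h1 := hmono hi
    have h2 := hmono hit
    simp only at h1 h2
    omega
  have hKm : K ≤ j + 1 := hj2 ▸ truncatedRM_snd_le (j + 1)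
  have hacc : ∀ i, j + 1 ≤ i → i < t → s (i + 1) = (rmProposal F a U x₀ r ξ i, K) ∧
      rmProposal F a U x₀ r ξ i ∈ U K := fun i hi hit => by
    have h1 : rmProposal F a U x₀ r ξ i ∈ U (s i).2 :=
      (truncatedRM_snd_eq_iff i).1 ((hσ (i + 1) (by omega) (by omega)).trans
        (hσ i hi hit.le).symm)
    have h2 := truncatedRM_succ_of_mem h1
    rw [← hs, hσ i hi hit.le] at h2
    rw [hσ i hi hit.le] at h1
    exact ⟨h2, h1⟩
  refine ⟨j + 1, t + 1, fun i => if i ≤ t then (s i).1 else rmProposal F a U x₀ r ξ t, hKm,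
    by omega,
    ?_, ?_, ?_, ?_, ?_⟩
  · have h1 := truncatedRM_succ_of_notMem hj3
    simp only [hjt, if_true]
    rw [hs, h1, ← hs]
    simp only
    congr 1
    omega
  · simp only [Nat.not_succ_le_self, if_false]
    rwa [hσ t hjt le_rfl] at ht3
  · intro i _ hi
    simp [Nat.lt_succ_iff.1 hi]
  · intro i hi hit
    obtain ⟨i, rfl⟩ := Nat.exists_eq_succ_of_ne_zero (show i ≠ 0 by omega)
    have h1 := hacc i (by omega) (by omega)
    have h2 : i + 1 ≤ t := by omega
    simp only [Nat.succ_eq_add_one, h2, if_true]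
    rw [h1.1]
    exact h1.2
  · intro i hi hit
    have h1 : i ≤ t := by omega
    by_cases h2 : i + 1 ≤ t
    · simp only [h1, h2, if_true]
      rw [(hacc i hi (by omega)).1]
      rfl
    · have h3 : i = t := by omega
      subst h3
      simp only [h2, le_refl, if_true, if_false]
      rfl

/-- The noise `F(x, ζ) - h(x)` while `x` is within distance `R` of `x⋆`. -/
noncomputable def localNoise (F : E → Ξ → E) (h : E → E) (xs : E) (R : ℝ) (p : E × Ξ) : E :=
  (Metric.closedBall xs R).indicator (fun x => F x p.2 - h x) p.1

/-- The partial sums of the noise terms of a Robbins–Monro sequence `x`, while it is within distance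
`R` of `x⋆`. -/
noncomputable def noiseSum (F : E → Ξ → E) (h : E → E) (xs : E) (a : ℕ → ℝ)
    (ξ : ℕ → Ξ) (x : ℕ → E) (R : ℝ)
    (n : ℕ) : E :=
  ∑ k ∈ Finset.range n, a (k + 1) • localNoise F h xs R (x k, ξ (k + 1))

variable {h : E → E} {xs : E} {α R δ : ℝ}

theorem add_noiseSum_succ {x y : ℕ → E} {i : ℕ} (hyx : y i = x i)
    (hy : y (i + 1) = y i - a (i + 1) • F (y i) (ξ (i + 1))) (hR : ‖y i - xs‖ ≤ R) :
    y (i + 1) + noiseSum F h xs a ξ x R (i + 1) =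
      y i + noiseSum F h xs a ξ x R i - a (i + 1) • h (y i) := by
  have h1 : x i ∈ Metric.closedBall xs R := by rwa [mem_closedBall_iff_norm, ← hyx]
  rw [noiseSum, Finset.sum_range_succ, ← noiseSum, localNoise]
  simp only [Set.indicator_of_mem h1]
  rw [hy, ← hyx, smul_sub]
  abel

/-- The iteration converges if it is truncated only finitely often. -/
theorem tendsto_truncatedRM_of_not_unbounded (hα : 0 < α) (ha0 : ∀ n, 0 < a n)
    (ha : Tendsto a atTop (𝓝 0)) (ha_sum : ¬ Summable a)
    (hnoise : ∀ R : ℕ, CauchySeq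
      (noiseSum F h xs a ξ (fun n => (truncatedRM F a U x₀ r ξ n).1) R))
    (hbdd : ∀ R : ℝ, ∃ M, ∀ x, ‖x - xs‖ ≤ R → ‖h x‖ ≤ M)
    (hU : ∀ k, Bornology.IsBounded (U k))
    (hmono : ∀ k, ∀ x ∈ U k, α * ‖x - xs‖ ^ 2 ≤ inner ℝ (h x) (x - xs))
    (hb : ¬ ∀ K, ∃ n, K ≤ (truncatedRM F a U x₀ r ξ n).2) :
    Tendsto (fun n => (truncatedRM F a U x₀ r ξ n).1) atTop (𝓝 xs) := by
  obtain ⟨N, hN⟩ := exists_truncatedRM_snd_eventually_const hb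
  set k := (truncatedRM F a U x₀ r ξ N).2
  have hacc : ∀ n, N ≤ n → rmProposal F a U x₀ r ξ n ∈ U k ∧
      truncatedRM F a U x₀ r ξ (n + 1) = (rmProposal F a U x₀ r ξ n, k) := fun n hn => by
    have h1 := (truncatedRM_snd_eq_iff n).1 ((hN (n + 1) (by omega)).trans (hN n hn).symm)
    have h2 := truncatedRM_succ_of_mem h1
    rw [hN n hn] at h1 h2
    exact ⟨h1, h2⟩
  have hmem : ∀ n, N + 1 ≤ n → (truncatedRM F a U x₀ r ξ n).1 ∈ U k := fun n hn => by
    obtain ⟨n, rfl⟩ := Nat.exists_eq_succ_of_ne_zero (show n ≠ 0 by omega)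
    obtain ⟨h1, h2⟩ := hacc n (by omega)
    rw [Nat.succ_eq_add_one, h2]
    exact h1
  obtain ⟨R₀, hR₀⟩ := (hU k).subset_closedBall xs
  obtain ⟨R, hR⟩ := exists_nat_ge R₀
  have hxR : ∀ n, N + 1 ≤ n → ‖(truncatedRM F a U x₀ r ξ n).1 - xs‖ ≤ R := fun n hn =>
    (mem_closedBall_iff_norm.1 (hR₀ (hmem n hn))).trans hR
  refine tendsto_of_eventually_euler hα ha0 ha ha_sum (hnoise R) hbdd
    (fun n hn => hmono k _ (hmem n hn)) hxR fun n hn => ?_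
  refine add_noiseSum_succ (y := fun n => (truncatedRM F a U x₀ r ξ n).1) rfl ?_ (hxR n hn)
  rw [(hacc n (by omega)).2]
  rfl

/-- If the iteration is truncated infinitely often, then its segments between truncations are
eventually perturbed Euler schemes with small steps and little noise. -/
theorem exists_perturbedEuler_segments (ha0 : ∀ n, 0 < a n) (ha : Tendsto a atTop (𝓝 0))
    (hnoise : ∀ R : ℕ, CauchySeq
      (noiseSum F h xs a ξ (fun n => (truncatedRM F a U x₀ r ξ n).1) R))
    (hub : ∀ K, ∃ n, K ≤ (truncatedRM F a U x₀ r ξ n).2) :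
    ∃ (m n : ℕ → ℕ) (y : ℕ → ℕ → E), (∀ K, m K < n K ∧ y K (m K) = r K (m K) ∧
      y K (n K) ∉ U (K + 1) ∧ ∀ i, m K < i → i < n K → y K i ∈ U (K + 1)) ∧
      ∀ (R : ℕ) (δ : ℝ), 0 < δ → ∀ᶠ K in atTop, IsPerturbedEuler h xs a R δ (m K) (n K) (y K)
        (noiseSum F h xs a ξ (fun n => (truncatedRM F a U x₀ r ξ n).1) R) := by
  choose m n y hm hmn hym hyn hyx hyU hy using
    fun K : ℕ => exists_segment hub (Nat.le_add_left 1 K)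
  refine ⟨m, n, y, fun K => ⟨hmn K, by simpa using hym K, hyn K, hyU K⟩, fun R δ hδ => ?_⟩
  have hmtop : Tendsto m atTop atTop :=
    tendsto_atTop_mono (fun K => (Nat.le_succ K).trans (hm K)) tendsto_id
  filter_upwards [hmtop.eventually (eventually_tail_small ha (hnoise R) hδ)] with K hK
  exact
    { step_nonneg := fun i _ _ => (ha0 _).le
      step_le := fun i hi _ => (hK i hi).1
      noise_le := fun i hi _ => (hK i hi).2
      add_eq := fun i hi hin hR => add_noiseSum_succ (hyx K i hi hin) (hy K i hi hin) hR }

/-- Segments that start in a ball eventually stay in every larger ball. -/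
theorem eventually_segment_mem_ball (hα : 0 < α)
    (hbdd : ∀ R : ℝ, ∃ M, ∀ x, ‖x - xs‖ ≤ R → ‖h x‖ ≤ M) {m n : ℕ → ℕ} {y : ℕ → ℕ → E}
    {w : ℕ → ℕ → E} {ρ ρ' : ℝ} (hρ0 : 0 ≤ ρ) (hρ : ρ < ρ')
    (hseg : ∀ (R : ℕ) (δ : ℝ), 0 < δ → ∀ᶠ K in atTop,
      IsPerturbedEuler h xs a R δ (m K) (n K) (y K) (w R))
    (hmn : ∀ K, m K < n K)
    (hmono : ∀ K i, m K ≤ i → i < n K →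
      α * ‖y K i - xs‖ ^ 2 ≤ inner ℝ (h (y K i)) (y K i - xs))
    (hstart : ∀ K, ‖y K (m K) - xs‖ ≤ ρ) :
    ∀ᶠ K in atTop, ‖y K (n K) - xs‖ < ρ' := by
  obtain ⟨R, hR⟩ := exists_nat_ge ρ'
  obtain ⟨M, hM⟩ := hbdd R
  have hM0 : 0 ≤ M := (norm_nonneg _).trans (hM xs (by simp))
  obtain ⟨δ, hδ0, -, hδ⟩ :=
    (IsPerturbedEuler.eventually_norm_sub_le hα hM0 hM hρ0 hρ hR one_pos).exists
  filter_upwards [hseg R δ hδ0] with K hK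
  exact (hδ a _ _ _ _ hK (hmono K) (hstart K) _ (hmn K).le le_rfl).1

/-- A sequence that is eventually close to a compact set, at every scale, has a cluster point. -/
theorem exists_tendsto_subseq_of_eventually_near {X : Type*} [NormedAddCommGroup X]
    [CompleteSpace X] {p : ℕ → X}
    (hp : ∀ ε > 0, ∃ C : Set X, IsCompact C ∧ ∀ᶠ K in atTop, ∃ c ∈ C, ‖p K - c‖ ≤ ε) :
    ∃ q, ∃ φ : ℕ → ℕ, StrictMono φ ∧ Tendsto (p ∘ φ) atTop (𝓝 q) := by
  have htb : TotallyBounded (Set.range p) := by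
    rw [Metric.totallyBounded_iff]
    intro ε hε
    obtain ⟨C, hC, hpC⟩ := hp (ε / 3) (by positivity)
    obtain ⟨N, hN⟩ := eventually_atTop.1 hpC
    obtain ⟨t, ht, htC⟩ := Metric.totallyBounded_iff.1 hC.totallyBounded (ε / 3) (by positivity)
    refine ⟨t ∪ p '' Set.Iio N, ht.union ((Set.finite_Iio N).image p), ?_⟩
    rintro _ ⟨K, rfl⟩
    rcases lt_or_ge K N with hK | hK
    · exact Set.mem_biUnion (.inr ⟨K, hK, rfl⟩) (Metric.mem_ball_self hε)
    · obtain ⟨c, hc, hpc⟩ := hN K hK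
      obtain ⟨z, hz, hcz⟩ := Set.mem_iUnion₂.1 (htC hc)
      refine Set.mem_biUnion (.inl hz) ?_
      rw [Metric.mem_ball] at hcz ⊢
      rw [← dist_eq_norm] at hpc
      linarith [dist_triangle (p K) c z]
  have hcomp : IsCompact (closure (Set.range p)) :=
    htb.closure.isCompact_of_isClosed isClosed_closure
  obtain ⟨q, -, φ, hφ, hq⟩ := hcomp.tendsto_subseq fun n => subset_closure (Set.mem_range_self n)
  exact ⟨q, φ, hφ, hq⟩

/-- Convergence of the iteration with expanding trust regions, on one path. -/
theorem tendsto_truncatedRM_of_expanding [CompleteSpace E] (hα : 0 < α) (ha0 : ∀ n, 0 < a n)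
    (ha : Tendsto a atTop (𝓝 0)) (ha_sum : ¬ Summable a)
    (hnoise : ∀ R : ℕ, CauchySeq
      (noiseSum F h xs a ξ (fun n => (truncatedRM F a U x₀ r ξ n).1) R))
    (hh : Continuous h) (hbdd : ∀ R : ℝ, ∃ M, ∀ x, ‖x - xs‖ ≤ R → ‖h x‖ ≤ M)
    (hmono : ∀ x y, α * ‖x - y‖ ^ 2 ≤ inner ℝ (h x - h y) (x - y)) (hxs : h xs = 0)
    (hUo : ∀ k, IsOpen (U k)) (hU : ∀ k, Bornology.IsBounded (U k)) (hUm : Monotone U)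
    (hUU : ⋃ n, U n = Set.univ)
    (hr : (∃ K : Set E, IsCompact K ∧ ∀ k n, r k n ∈ K) ∨
      ((∃ B : Set E, Bornology.IsBounded B ∧ ∀ k n, r k n ∈ B) ∧
        ∀ B : Set E, Bornology.IsBounded B → ∃ n, B ⊆ U n)) :
    Tendsto (fun n => (truncatedRM F a U x₀ r ξ n).1) atTop (𝓝 xs) := by
  have hmono' : ∀ x, α * ‖x - xs‖ ^ 2 ≤ inner ℝ (h x) (x - xs) := fun x => by
    simpa [hxs] using hmono x xs
  by_cases hb : ∀ K, ∃ n, K ≤ (truncatedRM F a U x₀ r ξ n).2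
  swap
  · exact tendsto_truncatedRM_of_not_unbounded hα ha0 ha ha_sum hnoise hbdd hU
      (fun _ x _ => hmono' x) hb
  exfalso
  obtain ⟨m, n, y, hy, hseg⟩ := exists_perturbedEuler_segments ha0 ha hnoise hb
  rcases hr with ⟨K₀, hK₀, hrK⟩ | ⟨⟨B, hB, hrB⟩, hBU⟩
  · obtain ⟨ρ₀, hρ₀⟩ := hK₀.isBounded.subset_closedBall xs
    set ρ := max ρ₀ 1
    have hρ0 : 0 < ρ := lt_max_of_lt_right one_pos
    have hKρ : ∀ x ∈ K₀, ‖x - xs‖ ≤ ρ := fun x hx =>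
      (mem_closedBall_iff_norm.1 (hρ₀ hx)).trans (le_max_left _ _)
    obtain ⟨R, hR⟩ := exists_nat_gt ρ
    obtain ⟨q, φ, hφ, hq⟩ := exists_tendsto_subseq_of_eventually_near
      (p := fun K => y K (n K)) fun ε hε => by
        obtain ⟨C, hC, hnear⟩ := IsPerturbedEuler.exists_isCompact_eventually_near hα hh hbdd hmono
          hxs hK₀ hρ0 hKρ hR hε
        obtain ⟨δ, hδ, hδ0⟩ := (hnear.and self_mem_nhdsWithin).exists
        refine ⟨C, hC, ?_⟩
        filter_upwards [hseg R δ hδ0] with K hK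
        exact hδ a _ _ _ _ hK ((hy K).2.1 ▸ hrK _ _) _ (hy K).1.le le_rfl
    obtain ⟨N, hN⟩ := Set.mem_iUnion.1 (hUU ▸ Set.mem_univ q)
    obtain ⟨j, hj, hjN⟩ :=
      ((hq.eventually ((hUo N).mem_nhds hN)).and (eventually_ge_atTop N)).exists
    exact (hy (φ j)).2.2.1 (hUm (hjN.trans ((hφ.id_le j).trans (Nat.le_succ _))) hj)
  · obtain ⟨ρ₀, hρ₀⟩ := hB.subset_closedBall xs
    have hstart : ∀ K, ‖y K (m K) - xs‖ ≤ max ρ₀ 0 := fun K => by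
      rw [(hy K).2.1]
      exact (mem_closedBall_iff_norm.1 (hρ₀ (hrB _ _))).trans (le_max_left _ _)
    obtain ⟨N, hN⟩ := hBU (Metric.ball xs (max ρ₀ 0 + 1)) Metric.isBounded_ball
    obtain ⟨K, hK, hKN⟩ := ((eventually_segment_mem_ball hα hbdd (le_max_right _ _)
      (lt_add_one _) hseg (fun K => (hy K).1) (fun K i _ _ => hmono' _) hstart).and
      (eventually_ge_atTop N)).exists
    exact (hy K).2.2.1 (hUm (hKN.trans (Nat.le_succ K)) (hN (mem_ball_iff_norm.2 hK)))

/-- Convergence of the iteration with a fixed trust region, on one path. -/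
theorem tendsto_truncatedRM_of_fixed (hα : 0 < α) (ha0 : ∀ n, 0 < a n)
    (ha : Tendsto a atTop (𝓝 0)) (ha_sum : ¬ Summable a)
    (hnoise : ∀ R : ℕ, CauchySeq
      (noiseSum F h xs a ξ (fun n => (truncatedRM F a U x₀ r ξ n).1) R))
    (hbdd : ∀ R : ℝ, ∃ M, ∀ x, ‖x - xs‖ ≤ R → ‖h x‖ ≤ M) {U₁ : Set E}
    (hmono : ∀ x ∈ U₁, α * ‖x - xs‖ ^ 2 ≤ inner ℝ (h x) (x - xs))
    (hU₁ : Bornology.IsBounded U₁) {R₀ R₁ : ℝ} (hR : R₀ < R₁) (hRU : Metric.ball xs R₁ ⊆ U₁)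
    (hr : ∀ k n, r k n ∈ Metric.ball xs R₀) (hU0 : U 0 ⊆ U₁) (hU : ∀ n, U (n + 1) = U₁) :
    Tendsto (fun n => (truncatedRM F a U x₀ r ξ n).1) atTop (𝓝 xs) := by
  have hUk : ∀ k, U k ⊆ U₁ := fun k => by
    cases k with
    | zero => exact hU0
    | succ k => rw [hU]
  by_cases hb : ∀ K, ∃ n, K ≤ (truncatedRM F a U x₀ r ξ n).2
  swap
  · exact tendsto_truncatedRM_of_not_unbounded hα ha0 ha ha_sum hnoise hbdd
      (fun k => hU₁.subset (hUk k)) (fun k x hx => hmono x (hUk k hx)) hb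
  exfalso
  obtain ⟨m, n, y, hy, hseg⟩ := exists_perturbedEuler_segments ha0 ha hnoise hb
  have hR₀ : 0 ≤ R₀ := (Metric.pos_of_mem_ball (hr 0 0)).le
  have hstart : ∀ K, y K (m K) ∈ Metric.ball xs R₀ := fun K => by
    rw [(hy K).2.1]
    exact hr _ _
  have hmem : ∀ K i, m K ≤ i → i < n K → y K i ∈ U₁ := fun K i hi hin => by
    rcases hi.eq_or_lt with rfl | hi
    · exact hRU (Metric.ball_subset_ball hR.le (hstart K))
    · exact hUk _ ((hy K).2.2.2 i hi hin)
  obtain ⟨K, hK⟩ := (eventually_segment_mem_ball hα hbdd hR₀ hR hseg (fun K => (hy K).1)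
    (fun K i hi hin => hmono _ (hmem K i hi hin))
    (fun K => (mem_ball_iff_norm.1 (hstart K)).le)).exists
  exact (hy K).2.2.1 (hU K ▸ hRU (mem_ball_iff_norm.2 hK))

end TruncatedRobbinsMonro

section AdaptedIteration

theorem measurable_apply_nat {Ω β : Type*} [MeasurableSpace Ω] [MeasurableSpace β]
    {f : ℕ → Ω → β} (hf : ∀ k, Measurable (f k)) {σ : Ω → ℕ} (hσ : Measurable σ) :
    Measurable fun ω => f (σ ω) ω :=
  (measurable_from_prod_countable_right (f := fun p : ℕ × Ω => f p.1 p.2) hf).comp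
    (hσ.prodMk measurable_id)

theorem truncatedRM_congr {E Ξ : Type*} [AddCommGroup E] [Module ℝ E] {F F' : E → Ξ → E}
    {a : ℕ → ℝ} {U : ℕ → Set E} {x₀ : E} {r : ℕ → ℕ → E} {ξ : ℕ → Ξ}
    (h : ∀ n x, F x (ξ (n + 1)) = F' x (ξ (n + 1))) (n : ℕ) :
    truncatedRM F a U x₀ r ξ n = truncatedRM F' a U x₀ r ξ n := by
  induction n with
  | zero => rfl
  | succ n ih =>
    simp only [truncatedRM]
    rw [ih, h n]

theorem Measurable.truncation {E Ω : Type*} {_ : MeasurableSpace Ω}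
    [TopologicalSpace E] [MeasurableSpace E] [OpensMeasurableSpace E]
    {U : ℕ → Set E} (hU : ∀ k, IsOpen (U k)) {p : Ω → E} (hp : Measurable p) {σ : Ω → ℕ}
    (hσ : Measurable σ) {r : ℕ → Ω → E} (hr : ∀ k, Measurable (r k))
    [∀ ω, Decidable (p ω ∈ U (σ ω))] :
    Measurable fun ω => if p ω ∈ U (σ ω) then (p ω, σ ω) else (r (σ ω) ω, σ ω + 1) := by
  have hset : MeasurableSet {q : E × ℕ | q.1 ∈ U q.2} := by
    have : {q : E × ℕ | q.1 ∈ U q.2} = ⋃ k, U k ×ˢ {k} := by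
      ext q
      simp
    rw [this]
    exact MeasurableSet.iUnion fun k => (hU k).measurableSet.prod (measurableSet_singleton k)
  exact Measurable.ite ((hp.prodMk hσ) hset) (hp.prodMk hσ)
    ((measurable_apply_nat hr hσ).prodMk ((measurable_of_countable Nat.succ).comp hσ))

theorem enorm_integral_le_of_sq {E Ξ : Type*} [NormedAddCommGroup E] [NormedSpace ℝ E]
    [MeasurableSpace Ξ] {γ : Measure Ξ} [IsProbabilityMeasure γ] {f : Ξ → E} {K : NNReal}
    (hK : ∫⁻ ζ, ‖f ζ‖ₑ ^ 2 ∂γ ≤ K) :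
    ‖∫ ζ, f ζ ∂γ‖ₑ ≤ (1 + K : NNReal) := by
  calc ‖∫ ζ, f ζ ∂γ‖ₑ ≤ ∫⁻ ζ, ‖f ζ‖ₑ ∂γ := enorm_integral_le_lintegral_enorm _
    _ ≤ ∫⁻ ζ, 1 + ‖f ζ‖ₑ ^ 2 ∂γ := by
        refine lintegral_mono fun ζ => ?_
        rcases le_total ‖f ζ‖ₑ 1 with h | h
        · exact h.trans le_self_add
        · exact (le_self_pow h two_ne_zero).trans le_add_self
    _ = 1 + ∫⁻ ζ, ‖f ζ‖ₑ ^ 2 ∂γ := by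
        rw [lintegral_add_left measurable_const]
        simp
    _ ≤ (1 + K : NNReal) := by
        push_cast
        gcongr

theorem exists_norm_integral_add_le {E Ξ : Type*} [NormedAddCommGroup E] [NormedSpace ℝ E]
    [MeasurableSpace Ξ] {γ : Measure Ξ} [IsProbabilityMeasure γ] {g : E × Ξ → E} {xs : E}
    (hb : ∀ B : Set E, Bornology.IsBounded B → ∃ K : NNReal, ∀ x ∈ B,
      ∫⁻ ζ, ‖g (x, ζ)‖ₑ ^ 2 ∂γ ≤ K) (R : ℝ) :
    ∃ M, ∀ x, ‖x - xs‖ ≤ R → ‖∫ ζ, g (x, ζ) ∂γ + x‖ ≤ M := by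
  obtain ⟨K, hK⟩ := hb (Metric.closedBall xs R) Metric.isBounded_closedBall
  refine ⟨(1 + K : NNReal) + (R + ‖xs‖), fun x hx => (norm_add_le _ _).trans ?_⟩
  have h1 : ‖∫ ζ, g (x, ζ) ∂γ‖ₑ ≤ (1 + K : NNReal) :=
    enorm_integral_le_of_sq (hK x (mem_closedBall_iff_norm.2 hx))
  have h2 : ‖x‖ ≤ R + ‖xs‖ := by
    calc ‖x‖ = ‖(x - xs) + xs‖ := by rw [sub_add_cancel]
      _ ≤ ‖x - xs‖ + ‖xs‖ := norm_add_le _ _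
      _ ≤ R + ‖xs‖ := by gcongr
  exact add_le_add (NNReal.coe_le_coe.2 (ENNReal.coe_le_coe.1 h1)) h2

variable {E : Type*} [NormedAddCommGroup E] [InnerProductSpace ℝ E]
  [SecondCountableTopology E] [MeasurableSpace E] [BorelSpace E]
  {Ξ : Type*} [MeasurableSpace Ξ] {γ : Measure Ξ} {g : E × Ξ → E}
  {Ω : Type*} [mΩ : MeasurableSpace Ω] {P : Measure Ω}
  {ℱ : Filtration ℕ mΩ} {ξ : ℕ → Ω → Ξ} {a : ℕ → ℝ}
  {x₀ : Ω → E} {r : ℕ → ℕ → Ω → E} {U : ℕ → Set E}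

theorem measurable_truncatedRM {F : E → Ξ → E} (hF : Measurable fun p : E × Ξ => F p.1 p.2)
    (hξ_meas : ∀ n, Measurable[ℱ (n + 1)] (ξ (n + 1))) (hx₀ : Measurable[ℱ 0] x₀)
    (hr : ∀ k n, Measurable[ℱ n] (r k n)) (hU : ∀ k, IsOpen (U k)) (n : ℕ) :
    Measurable[ℱ n] fun ω =>
      truncatedRM F a U (x₀ ω) (fun k n => r k n ω) (fun n => ξ n ω) n := by
  classical
  induction n with
  | zero => exact hx₀.prodMk measurable_const
  | succ n ih =>
    have ih' := ih.mono (ℱ.mono (Nat.le_succ n)) le_rfl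
    set s : Ω → E × ℕ := fun ω =>
      truncatedRM F a U (x₀ ω) (fun k n => r k n ω) (fun n => ξ n ω) n
    have hx : Measurable[ℱ (n + 1)] fun ω => (s ω).1 := measurable_fst.comp ih'
    have hσ : Measurable[ℱ (n + 1)] fun ω => (s ω).2 := measurable_snd.comp ih'
    have hp : Measurable[ℱ (n + 1)] fun ω =>
        (s ω).1 - a (n + 1) • F (s ω).1 (ξ (n + 1) ω) :=
      hx.sub ((hF.comp (hx.prodMk (hξ_meas n))).const_smul _)
    exact Measurable.truncation hU hp hσ fun k => hr k (n + 1)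

variable [IsProbabilityMeasure γ]

variable [CompleteSpace E] [IsProbabilityMeasure P]

/-- The local noise of the truncated iteration is summable on almost every path. -/
theorem ae_cauchySeq_noiseSum {xs : E} (hgm : Measurable g)
    (hgc : ∀ᵐ ζ ∂γ, Continuous fun x => g (x, ζ))
    (hb : ∀ B : Set E, Bornology.IsBounded B → ∃ K : NNReal, ∀ x ∈ B,
      ∫⁻ ζ, ‖g (x, ζ)‖ₑ ^ 2 ∂γ ≤ K)
    (ha_sq : Summable fun n => a n ^ 2)
    (hξ_meas : ∀ n, Measurable[ℱ (n + 1)] (ξ (n + 1)))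
    (hξ_law : ∀ n, P.map (ξ (n + 1)) = γ)
    (hξ_indep : ∀ n, Indep (MeasurableSpace.comap (ξ (n + 1)) inferInstance) (ℱ n) P)
    (hx₀ : Measurable[ℱ 0] x₀) (hr : ∀ k n, Measurable[ℱ n] (r k n)) (hU : ∀ k, IsOpen (U k)) :
    ∀ᵐ ω ∂P, ∀ R : ℕ, CauchySeq (noiseSum (fun x ζ => g (x, ζ) + x)
      (fun x => ∫ ζ, g (x, ζ) ∂γ + x) xs a (fun n => ξ n ω)
      (fun n => (truncatedRM (fun x ζ => g (x, ζ) + x) a U (x₀ ω) (fun k n => r k n ω)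
        (fun n => ξ n ω) n).1) R) := by
  refine ae_all_iff.2 fun R => ?_
  set G : E → E := fun x => ∫ ζ, g (x, ζ) ∂γ
  have hG : Continuous G := continuous_integral_of_bounded_sq hgm hgc hb
  obtain ⟨K, hK⟩ := hb (Metric.closedBall xs R) Metric.isBounded_closedBall
  have hDeq : localNoise (fun x ζ => g (x, ζ) + x) (fun x => G x + x) xs R =
      (Prod.fst ⁻¹' Metric.closedBall xs R).indicator fun p : E × Ξ => g p - G p.1 := by
    ext p
    by_cases hp : p.1 ∈ Metric.closedBall xs R
    · have hp' : p ∈ (Prod.fst ⁻¹' Metric.closedBall xs R : Set (E × Ξ)) := hp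
      rw [localNoise, Set.indicator_of_mem hp, Set.indicator_of_mem hp', add_sub_add_right_eq_sub]
    · have hp' : p ∉ (Prod.fst ⁻¹' Metric.closedBall xs R : Set (E × Ξ)) := hp
      rw [localNoise, Set.indicator_of_notMem hp, Set.indicator_of_notMem hp']
  have hDm : Measurable (localNoise (fun x ζ => g (x, ζ) + x) (fun x => G x + x) xs R) := by
    rw [hDeq]
    exact (hgm.sub (hG.measurable.comp measurable_fst)).indicator
      (measurableSet_closedBall.preimage measurable_fst)
  refine ae_cauchySeq_sum_noise (K := 2 * (K + (1 + K) ^ 2)) hξ_meas hξ_law hξ_indep ha_sq hDm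
    (fun x => ?_) (fun x => ?_)
    (fun n => measurable_fst.comp (measurable_truncatedRM (by fun_prop) hξ_meas hx₀ hr hU n))
  · by_cases hx : x ∈ Metric.closedBall xs R
    · have hle : ∀ ζ, ‖localNoise (fun x ζ => g (x, ζ) + x) (fun x => G x + x) xs R (x, ζ)‖ₑ ^ 2 ≤
          2 * (‖g (x, ζ)‖ₑ ^ 2 + ‖G x‖ₑ ^ 2) := fun ζ => by
        rw [localNoise, Set.indicator_of_mem hx, add_sub_add_right_eq_sub]
        have h1 : ‖g (x, ζ) - G x‖₊ ^ 2 ≤ 2 * (‖g (x, ζ)‖₊ ^ 2 + ‖G x‖₊ ^ 2) :=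
          (pow_le_pow_left₀ zero_le (nnnorm_sub_le _ _) 2).trans add_sq_le
        simp only [enorm]
        exact_mod_cast h1
      have hgx : Measurable fun ζ => g (x, ζ) := hgm.comp measurable_prodMk_left
      calc _ ≤ ∫⁻ ζ, 2 * (‖g (x, ζ)‖ₑ ^ 2 + ‖G x‖ₑ ^ 2) ∂γ := lintegral_mono hle
        _ = 2 * (∫⁻ ζ, ‖g (x, ζ)‖ₑ ^ 2 ∂γ + ‖G x‖ₑ ^ 2) := by
            rw [lintegral_const_mul _ (by fun_prop), lintegral_add_right _ measurable_const]
            simp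
        _ ≤ ((2 * (K + (1 + K) ^ 2) : NNReal) : ENNReal) := by
            push_cast
            gcongr
            · exact hK x hx
            · exact_mod_cast enorm_integral_le_of_sq (hK x hx)
    · simp [localNoise, Set.indicator_of_notMem hx]
  · by_cases hx : x ∈ Metric.closedBall xs R
    · simp only [localNoise, Set.indicator_of_mem hx, add_sub_add_right_eq_sub]
      rw [integral_sub (integrable_of_bounded_sq hgm hb x) (integrable_const _)]
      simp
    · simp [localNoise, Set.indicator_of_notMem hx]

end AdaptedIteration

namespace CameronMartin

variable {H : Type*} [NormedAddCommGroup H] [InnerProductSpace ℝ H] [CompleteSpace H]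
  (S : H →L[ℝ] H)

instance instSecondCountableTopology [SecondCountableTopology H] :
    SecondCountableTopology (CameronMartin S) :=
  (invIsometry S).toHomeomorph.secondCountableTopology

theorem grad_eq_gradient (Φ : H → ℝ) (x : CameronMartin S) (m₀ ξ : H) :
    grad S Φ (incl S x + m₀ + ξ) =
      gradient (fun x : CameronMartin S => Φ (incl S x + m₀ + ξ)) x := by
  have h1 : (fun h : CameronMartin S => Φ (incl S x + m₀ + ξ + incl S h)) =
      fun h => (fun x : CameronMartin S => Φ (incl S x + m₀ + ξ)) (x + h) := by
    ext h
    simp only [map_add]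
    congr 1
    abel
  rw [grad, h1, gradient,
    fderiv_comp_add_left (f := fun x : CameronMartin S => Φ (incl S x + m₀ + ξ)) x, add_zero,
    gradient]

end CameronMartin

theorem hasGradientAt_norm_sq_div_two {E : Type*} [NormedAddCommGroup E] [InnerProductSpace ℝ E]
    [CompleteSpace E] (x : E) : HasGradientAt (fun x : E => ‖x‖ ^ 2 / 2) x x := by
  rw [hasGradientAt_iff_hasFDerivAt]
  have h := (hasStrictFDerivAt_norm_sq x).hasFDerivAt.mul_const (1 / 2 : ℝ)
  refine (h.congr_fderiv ?_).congr_of_eventuallyEq (.of_forall fun y => by ring)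
  ext u
  simp

theorem theorem3
    {H : Type*} [NormedAddCommGroup H] [InnerProductSpace ℝ H] [CompleteSpace H]
    [SecondCountableTopology H] [MeasurableSpace H] [BorelSpace H]
    -- `γ = N(0, C₀)`, and `S = √C₀` is the positive square root of `C₀`
    (γ : Measure H) (C₀ S : H →L[ℝ] H) (hγ : IsCentredGaussian γ C₀)
    (hS : S.IsPositive) (hSC : S ∘L S = C₀)
    -- `μ` has density `exp (-Φ) / Z` with respect to `μ₀ = N(m₀, C₀)`
    (m₀ : H) (Φ : H → ℝ) (hΦ : Measurable Φ) (Z : ℝ) (hZ : 0 < Z)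
    (μ : Measure H) [IsProbabilityMeasure μ]
    (hμ : μ = (gaussianWithMean γ m₀).withDensity
      fun u => ENNReal.ofReal (Real.exp (-Φ u) / Z))
    -- for almost every `ξ`, the function `x ↦ Φ (x + m₀ + ξ)` is twice Fréchet differentiable on `H¹`
    (hdiff : ∀ᵐ ξ : H ∂γ,
      Differentiable ℝ (fun x : CameronMartin S => Φ (CameronMartin.incl S x + m₀ + ξ)) ∧
      Differentiable ℝ
        (fderiv ℝ fun x : CameronMartin S => Φ (CameronMartin.incl S x + m₀ + ξ)))
    -- `x⋆` is a critical point of `J`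
    (xs : CameronMartin S) (hfin : relEntropy S γ μ m₀ xs ≠ ⊤)
    (hcrit : HasFDerivAt (objective S γ μ m₀) (0 : CameronMartin S →L[ℝ] ℝ) xs)
    -- `x ↦ 𝔼 ‖√C₀ Φ'(x + m₀ + ξ)‖²` is bounded on bounded subsets of `H¹`
    (hbound : ∀ B : Set (CameronMartin S), Bornology.IsBounded B → ∃ K : NNReal, ∀ x ∈ B,
      ∫⁻ ξ, ‖CameronMartin.grad S Φ (CameronMartin.incl S x + m₀ + ξ)‖ₑ ^ 2 ∂γ ≤ K)
    -- coercivity of `J''` on a convex neighbourhood of `x⋆`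
    (Us : Set (CameronMartin S)) (hUs : Convex ℝ Us) (hUs_nhds : Us ∈ 𝓝 xs)
    (α : ℝ) (hα : 0 < α)
    (hcoer : ∀ x ∈ Us, ∀ u : CameronMartin S,
      α * ‖u‖ ^ 2 ≤ fderiv ℝ (fderiv ℝ (objective S γ μ m₀)) x u u)
    -- the step sizes
    (a : ℕ → ℝ) (ha : ∀ n, 0 < a n) (ha_sum : ¬ Summable a)
    (ha_sq : Summable fun n => a n ^ 2)
    -- the samples `ξ₁, ξ₂, …` of `N(0, C₀)`: adapted, and each independent of the past
    {Ω : Type*} [mΩ : MeasurableSpace Ω] (P : Measure Ω) [IsProbabilityMeasure P]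
    (ℱ : Filtration ℕ mΩ) (ξ : ℕ → Ω → H)
    (hξ_meas : ∀ n, Measurable[ℱ (n + 1)] (ξ (n + 1)))
    (hξ_law : ∀ n, P.map (ξ (n + 1)) = γ)
    (hξ_indep : ∀ n, Indep (MeasurableSpace.comap (ξ (n + 1)) inferInstance) (ℱ n) P)
    -- the initial point and the restart points, which may be random
    (x₀ : Ω → CameronMartin S) (hx₀ : StronglyMeasurable[ℱ 0] x₀)
    (r : ℕ → ℕ → Ω → CameronMartin S) (hr : ∀ k n, StronglyMeasurable[ℱ n] (r k n)) :
    -- expanding trust regions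
    (Us = Set.univ →
      ∀ U : ℕ → Set (CameronMartin S), (∀ n, IsOpen (U n)) → (∀ n, Bornology.IsBounded (U n)) →
        Monotone U → ⋃ n, U n = Set.univ →
        (∀ ω, x₀ ω ∈ U 0) → (∀ k n ω, r k n ω ∈ U (k + 1)) →
        ((∃ K : Set (CameronMartin S), IsCompact K ∧ ∀ k n ω, r k n ω ∈ K) ∨
          ((∃ B : Set (CameronMartin S), Bornology.IsBounded B ∧ ∀ k n ω, r k n ω ∈ B) ∧
            ∀ B : Set (CameronMartin S), Bornology.IsBounded B → ∃ n, B ⊆ U n)) →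
        ∀ᵐ ω ∂P, Tendsto
          (fun n => (truncatedRM (noisyGradient S Φ m₀) a U (x₀ ω) (fun k n => r k n ω)
            (fun n => ξ n ω) n).1) atTop (𝓝 xs)) ∧
    -- fixed trust regions
    (∀ (U₀ U₁ : Set (CameronMartin S)) (R₀ R₁ : ℝ),
      IsOpen U₁ → Bornology.IsBounded U₁ → Convex ℝ U₁ → U₁ ⊆ Us → xs ∈ U₁ →
      R₀ < R₁ → U₀ ⊆ Metric.ball xs R₀ → Metric.ball xs R₁ ⊆ U₁ →
      (∀ ω, x₀ ω ∈ U₀) → (∀ k n ω, r k n ω ∈ U₀) →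
      ∀ U : ℕ → Set (CameronMartin S), IsOpen (U 0) → (U 0 = U₀ ∨ U 0 = U₁) →
        (∀ n, U (n + 1) = U₁) →
        ∀ᵐ ω ∂P, Tendsto
          (fun n => (truncatedRM (noisyGradient S Φ m₀) a U (x₀ ω) (fun k n => r k n ω)
            (fun n => ξ n ω) n).1) atTop (𝓝 xs)) := by
  have := hγ.isGaussian
  let _ : MeasurableSpace (CameronMartin S) := borel _
  have : BorelSpace (CameronMartin S) := ⟨rfl⟩
  set φ : CameronMartin S → H → ℝ := fun x ξ => Φ (CameronMartin.incl S x + m₀ + ξ) with hφ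
  have hφm : Measurable fun p : CameronMartin S × H => φ p.1 p.2 := by fun_prop
  obtain ⟨g, hgm, hgg⟩ := exists_measurable_gradient hφm (hdiff.mono fun ξ hξ => hξ.1)
  have hg : ∀ᵐ ζ ∂γ, ∀ x, HasGradientAt (fun x => φ x ζ) (g (x, ζ)) x := by
    filter_upwards [hgg, hdiff] with ζ h1 h2 x
    rw [h1]
    exact (h2.1 x).hasGradientAt
  have hgc : ∀ᵐ ζ ∂γ, Continuous fun x => g (x, ζ) := by
    filter_upwards [hgg, hdiff] with ζ h1 h2
    simp_rw [h1]
    exact (InnerProductSpace.toDual ℝ (CameronMartin S)).symm.continuous.comp h2.2.continuous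
  have hgrad : ∀ᵐ ζ ∂γ, ∀ x, CameronMartin.grad S Φ (CameronMartin.incl S x + m₀ + ζ) =
      g (x, ζ) := by
    filter_upwards [hgg] with ζ h1 x
    rw [h1, CameronMartin.grad_eq_gradient]
  have hb : ∀ B : Set (CameronMartin S), Bornology.IsBounded B → ∃ K : NNReal, ∀ x ∈ B,
      ∫⁻ ζ, ‖g (x, ζ)‖ₑ ^ 2 ∂γ ≤ K := fun B hB => by
    obtain ⟨K, hK⟩ := hbound B hB
    refine ⟨K, fun x hx => le_trans (le_of_eq (lintegral_congr_ae ?_)) (hK x hx)⟩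
    filter_upwards [hgrad] with ζ hζ
    rw [hζ]
  -- the gradient of the objective
  have hint : ∀ x, Integrable (φ x) γ :=
    integrable_add_iff_of_gradient hgm hg hgc hb
      (integrable_of_relEntropy_ne_top hγ hS hSC hΦ hZ hμ hfin)
  set h : CameronMartin S → CameronMartin S := fun x => ∫ ζ, g (x, ζ) ∂γ + x with hh
  have hJ : ∀ x, HasGradientAt (objective S γ μ m₀) (h x) x := fun x => by
    have h1 : objective S γ μ m₀ = fun x => ∫ ζ, φ x ζ ∂γ + ‖x‖ ^ 2 / 2 + Real.log Z :=
      funext fun x => objective_eq hγ hS hSC hΦ hZ hμ (hint x)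
    have h2 := (hasGradientAt_integral_of_bounded_sq hgm hg hgc hb hint x).hasFDerivAt
    have h3 := (hasGradientAt_norm_sq_div_two x).hasFDerivAt
    rw [h1, hasGradientAt_iff_hasFDerivAt, hh, map_add]
    exact (h2.add h3).add_const _
  have hxs : h xs = 0 := by
    have := (hJ xs).hasFDerivAt.unique hcrit
    simpa using this
  have hmono : ∀ x ∈ Us, ∀ y ∈ Us, α * ‖x - y‖ ^ 2 ≤ inner ℝ (h x - h y) (x - y) :=
    fun x hx y hy => mul_norm_sq_le_inner_sub hJ hUs hα hcoer hx hy
  have hxsUs : xs ∈ Us := mem_of_mem_nhds hUs_nhds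
  have hhc : Continuous h := (continuous_integral_of_bounded_sq hgm hgc hb).add continuous_id
  have hbdd : ∀ R : ℝ, ∃ M, ∀ x, ‖x - xs‖ ≤ R → ‖h x‖ ≤ M := exists_norm_integral_add_le hb
  have ha0 : Tendsto a atTop (𝓝 0) := by
    have := ha_sq.tendsto_atTop_zero
    have h1 := (Real.continuous_sqrt.tendsto 0).comp this
    rw [Real.sqrt_zero] at h1
    exact h1.congr fun n => Real.sqrt_sq (ha n).le
  -- the iteration is driven by the measurable version of the noisy gradient
  have hcongr : ∀ᵐ ω ∂P, ∀ n x, noisyGradient S Φ m₀ x (ξ (n + 1) ω) =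
      g (x, ξ (n + 1) ω) + x := by
    refine ae_all_iff.2 fun n => ?_
    have h1 := hgrad
    rw [← hξ_law n] at h1
    filter_upwards [ae_of_ae_map ((hξ_meas n).mono (ℱ.le _) le_rfl).aemeasurable h1] with ω hω x
    rw [noisyGradient, hω]
  have hnoise := fun (U : ℕ → Set (CameronMartin S)) (hU : ∀ k, IsOpen (U k)) =>
    ae_cauchySeq_noiseSum (xs := xs) hgm hgc hb ha_sq hξ_meas hξ_law hξ_indep hx₀.measurable
      (fun k n => (hr k n).measurable) hU
  constructor
  · intro hUsuniv U hUo hUb hUm hUU _ _ hrr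
    filter_upwards [hnoise U hUo, hcongr] with ω hω hω'
    simp_rw [truncatedRM_congr (F := noisyGradient S Φ m₀) (F' := fun x ζ => g (x, ζ) + x)
      (ξ := fun n => ξ n ω) hω']
    refine tendsto_truncatedRM_of_expanding hα ha ha0 ha_sum hω hhc hbdd
      (fun x y => hmono x (hUsuniv ▸ Set.mem_univ x) y (hUsuniv ▸ Set.mem_univ y)) hxs hUo hUb hUm
      hUU ?_
    rcases hrr with ⟨K, hK, hrK⟩ | ⟨⟨B, hB, hrB⟩, hBU⟩
    · exact .inl ⟨K, hK, fun k n => hrK k n ω⟩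
    · exact .inr ⟨⟨B, hB, fun k n => hrB k n ω⟩, hBU⟩
  · intro U₀ U₁ R₀ R₁ hU₁o hU₁b _ hU₁Us _ hR hU₀ hRU _ hrU₀ U hU0o hU0 hU
    have hUo : ∀ k, IsOpen (U k) := fun k => by
      cases k with
      | zero => exact hU0o
      | succ k => rwa [hU]
    have hU0' : U 0 ⊆ U₁ := by
      rcases hU0 with h0 | h0
      · rw [h0]
        exact hU₀.trans ((Metric.ball_subset_ball hR.le).trans hRU)
      · exact h0.le
    filter_upwards [hnoise U hUo, hcongr] with ω hω hω'
    simp_rw [truncatedRM_congr (F := noisyGradient S Φ m₀) (F' := fun x ζ => g (x, ζ) + x)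
      (ξ := fun n => ξ n ω) hω']
    exact tendsto_truncatedRM_of_fixed hα ha ha0 ha_sum hω hbdd
      (fun x hx => by simpa [hxs] using hmono x (hU₁Us hx) xs hxsUs) hU₁b hR hRU
      (fun k n => hU₀ (hrU₀ k n ω)) hU0' hU
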